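/- Let $n\ge 1$ and $t>0$, let $S^{2n+1}=\{z\in\mathbb C^{n+1}:|z|=1\}$, $\langle z,p\rangle=\sum_j\overline{z_j}\,p_j$, and $1=(1,0,\ldots,0)$. For $Q=(z_1,\ldots,z_{n+1})\in S^{2n+1}$ let $\vartheta_1(Q)=\arccos|z_1|\in[0,\pi/2]$ and $\varphi_1(Q)=\arg z_1\in(-\pi,\pi]$ (with $\arg 0=0$). A CR-bicharacteristic on $[0,t]$ is a solution $(z(s),p(s))$ of Hamilton's equations $\dot z=\nabla_pH$, $\dot p=-\nabla_zH$ for the Hamiltonian $H(z,p)=\frac12\big(|z|^2|p|^2-|\langle z,p\rangle|^2\big)$ of the CR-subLaplacian, with $|z(s)|=1$ and $\mathrm{Re}\,\langle z(s),p(s)\rangle=0$. Along it $\Omega=|p|$ is constant ($\Omega^2=2H+\tau_1^2$, $\tau_1=\mathrm{Im}\,\langle z,p\rangle$); put $\eta=\Omega t$. A CR-geodesic joining $1$ and $Q$ is the projection $z(s)$, $0\le s\le t$, of a CR-bicharacteristic with $z(0)=1$, $z(t)=Q$, which is local: there is a monotone (non-decreasing or non-increasing) function $\varphi_1(s)$ on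 $[0,t]$ with $\varphi_1(0)=0$, $\varphi_1(t)=\varphi_1(Q)$ and $z_1(s)=|z_1(s)|e^{i\varphi_1(s)}$. Let $\mathcal G(Q)$ be either the set of those CR-geodesics joining $1$ and $Q$ for which $\eta$ lies in an interval $[2k\pi,(2k+1)\pi]$, $k=0,1,2,\ldots$; or, if $\varphi_1(Q)\ne\pi$, the set of all CR-geodesics joining $1$ and $Q$. In both cases the following holds. (i) If $\vartheta_1(Q)>0$, then $\mathcal G(Q)$ is finite and non-empty, and its number of elements is odd when those with $\tan\eta=\eta$ are counted twice. If $\vartheta_1(Q)=0$ and $Q\ne1$, then $\mathcal G(Q)$ is infinite, and infinitely many different lengths occur in it. (ii) The equation $\tan\eta=\eta$ has exactly one root $\eta_1$ in $[\pi,3\pi/2]$. If $\vartheta_1(Q)\ge\eta_1-\pi$, then $\mathcal G(Q)$ has exactly one element. -/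

import Mathlib

noncomputable section

/-- The complex Euclidean space `ℂ^{n+1}`; the sphere `S^{2n+1}` is `{z | ‖z‖ = 1}`. -/
abbrev CSpace (n : ℕ) : Type := EuclideanSpace ℂ (Fin (n + 1))

/-- The point `1 = (1, 0, …, 0)`. -/
def basePoint (n : ℕ) : CSpace n := EuclideanSpace.single 0 1

/-- The spherical coordinate `ϑ₁ ∈ [0, π/2]` of a point of the sphere: `cos ϑ₁ = |z₁|`. -/
def theta1 {n : ℕ} (z : CSpace n) : ℝ := Real.arccos ‖z 0‖

/-- The spherical coordinate `φ₁ ∈ (-π, π]`: the argument of `z₁`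
(it is not determined when `z₁ = 0`; the value is then `0`). -/
def phi1 {n : ℕ} (z : CSpace n) : ℝ := Complex.arg (z 0)

/-- The Hamiltonian of the CR-subLaplacian (the principal symbol of `-Δ_C`) on the cotangent bundle
of the sphere. For `‖z‖ = 1` this is `½ ‖p - ⟪z, p⟫ z‖²`, half the squared norm of the component of
the covector `p` along the CR tangent space, which is the complex orthogonal complement of `z`;
for `p` tangent to the sphere it is also `½ (‖p‖² - ⟪p, iz⟫_ℝ²)`. -/
def crHamiltonian {n : ℕ} (z p : CSpace n) : ℝ :=
  (‖z‖ ^ 2 * ‖p‖ ^ 2 - ‖inner ℂ z p‖ ^ 2) / 2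

/-- The gradient `∇_p H`. -/
def crHamiltonianGradP {n : ℕ} (z p : CSpace n) : CSpace n :=
  ((‖z‖ ^ 2 : ℝ) : ℂ) • p - (inner ℂ z p : ℂ) • z

/-- The gradient `∇_z H`. -/
def crHamiltonianGradZ {n : ℕ} (z p : CSpace n) : CSpace n :=
  ((‖p‖ ^ 2 : ℝ) : ℂ) • z - (inner ℂ p z : ℂ) • p

theorem crHamiltonian_comm {n : ℕ} (z p : CSpace n) : crHamiltonian z p = crHamiltonian p z := by
  unfold crHamiltonian
  rw [norm_inner_symm, mul_comm]

/-- `crHamiltonianGradP` is the gradient of `H` in `p`, for the real inner product `Re ⟪·, ·⟫`. -/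
theorem hasDerivAt_crHamiltonian_p {n : ℕ} (z p v : CSpace n) :
    HasDerivAt (fun ε : ℝ => crHamiltonian z (p + (ε : ℂ) • v))
      (inner ℂ (crHamiltonianGradP z p) v).re 0 := by
  have key : (fun ε : ℝ => crHamiltonian z (p + (ε : ℂ) • v)) = fun ε : ℝ =>
      crHamiltonian z p + ε * (inner ℂ (crHamiltonianGradP z p) v).re
        + ε ^ 2 * crHamiltonian z v := by
    funext ε
    have h1 : ‖p + (ε : ℂ) • v‖ ^ 2 = ‖p‖ ^ 2 + 2 * (ε * (inner ℂ p v).re) + ε ^ 2 * ‖v‖ ^ 2 := by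
      rw [@norm_add_sq ℂ, inner_smul_right, norm_smul]
      simp [mul_pow]
    have h2 : ‖inner ℂ z (p + (ε : ℂ) • v)‖ ^ 2 = ‖inner ℂ z p‖ ^ 2
        + 2 * (ε * ((starRingEnd ℂ) (inner ℂ z p) * inner ℂ z v).re)
        + ε ^ 2 * ‖inner ℂ z v‖ ^ 2 := by
      rw [inner_add_right, inner_smul_right, ← Complex.normSq_eq_norm_sq,
        ← Complex.normSq_eq_norm_sq, ← Complex.normSq_eq_norm_sq]
      simp [Complex.normSq_apply, -inner_conj_symm]
      ring
    have h3 : (inner ℂ (crHamiltonianGradP z p) v).re = ‖z‖ ^ 2 * (inner ℂ p v).re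
        - ((starRingEnd ℂ) (inner ℂ z p) * inner ℂ z v).re := by
      unfold crHamiltonianGradP
      rw [inner_sub_left, inner_smul_left, inner_smul_left, Complex.conj_ofReal, Complex.sub_re,
        Complex.re_ofReal_mul]
    rw [h3]
    unfold crHamiltonian
    rw [h1, h2]
    ring
  rw [key]
  have h := (((hasDerivAt_id (0 : ℝ)).mul_const (inner ℂ (crHamiltonianGradP z p) v).re).const_add
    (crHamiltonian z p)).add (((hasDerivAt_id (0 : ℝ)).pow 2).mul_const (crHamiltonian z v))
  exact h.congr_deriv (by simp)

/-- `crHamiltonianGradZ` is the gradient of `H` in `z`, for the real inner product `Re ⟪·, ·⟫`. -/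
theorem hasDerivAt_crHamiltonian_z {n : ℕ} (z p v : CSpace n) :
    HasDerivAt (fun ε : ℝ => crHamiltonian (z + (ε : ℂ) • v) p)
      (inner ℂ (crHamiltonianGradZ z p) v).re 0 := by
  have h := hasDerivAt_crHamiltonian_p p z v
  simp only [crHamiltonian_comm p] at h
  exact h

/-- A CR-bicharacteristic `s ↦ (z(s), p(s))`, `0 ≤ s ≤ t`: a solution of Hamilton's equations
`ż = ∇_p H`, `ṗ = -∇_z H` in the cotangent bundle of the sphere, which is identified with
`{(z, p) | ‖z‖ = 1, Re ⟪z, p⟫ = 0}`. Along it `E² = 2H`, `τ₁ = Im ⟪z, p⟫` and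
`Ω = √(E² + τ₁²) = ‖p‖` are constant. -/
structure IsCRBicharacteristic {n : ℕ} (t : ℝ) (z p : ℝ → CSpace n) : Prop where
  norm_eq : ∀ s ∈ Set.Icc 0 t, ‖z s‖ = 1
  tangent : ∀ s ∈ Set.Icc 0 t, (inner ℂ (z s) (p s)).re = 0
  deriv_z : ∀ s ∈ Set.Icc 0 t,
    HasDerivWithinAt z (crHamiltonianGradP (z s) (p s)) (Set.Icc 0 t) s
  deriv_p : ∀ s ∈ Set.Icc 0 t,
    HasDerivWithinAt p (-crHamiltonianGradZ (z s) (p s)) (Set.Icc 0 t) s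

/-- A curve from `1` is local on `[0, t]`: the angle `φ₁` of `z₁` can be followed monotonically along
the curve from `0` to the angle `φ₁ ∈ (-π, π]` of the endpoint. Such an angle function takes its
values between `0` and `φ₁ ∈ (-π, π]`; so it is continuous wherever `z₁ ≠ 0`, and can only jump by
`±π` where the curve runs through `z₁ = 0`. -/
def IsLocalCurve {n : ℕ} (t : ℝ) (z : ℝ → CSpace n) : Prop :=
  ∃ φ : ℝ → ℝ, (MonotoneOn φ (Set.Icc 0 t) ∨ AntitoneOn φ (Set.Icc 0 t)) ∧
    φ 0 = 0 ∧ φ t = phi1 (z t) ∧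
    ∀ s ∈ Set.Icc 0 t, z s 0 = (‖z s 0‖ : ℂ) * Complex.exp (Complex.I * (φ s : ℂ))

/-- Parametrizations `z` of the (local) CR-geodesics which join `1` to `Q` in time `t`: projections
of CR-bicharacteristics, here those whose parameter `η = Ω t` lies in `W`. Only the values of `z`
on `[0, t]` matter. -/
def crGeodesicCurves {n : ℕ} (t : ℝ) (Q : CSpace n) (W : Set ℝ) : Set (ℝ → CSpace n) :=
  {z | ∃ p : ℝ → CSpace n, IsCRBicharacteristic t z p ∧ z 0 = basePoint n ∧ z t = Q ∧
    IsLocalCurve t z ∧ ‖p 0‖ * t ∈ W}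

/-- The (local) CR-geodesics which join `1` to `Q` in time `t`, as maps on `[0, t]`, whose parameter
`η = Ω t` lies in `W`. -/
def crGeodesics {n : ℕ} (t : ℝ) (Q : CSpace n) (W : Set ℝ) : Set (Set.Icc (0 : ℝ) t → CSpace n) :=
  (Set.Icc (0 : ℝ) t).domRestrict '' crGeodesicCurves t Q W

/-- The range of `η` used for spherical coordinates in which `ϑ₁` leaves `0` in the positive
direction: the union of the intervals `[kπ, (k+1)π]` with even `k ≥ 0`. -/
def evenWindings : Set ℝ :=
  {η | ∃ k : ℕ, 2 * k * Real.pi ≤ η ∧ η ≤ (2 * k + 1) * Real.pi}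

/-- The parameters `η` with `tan η = η`, at which two solutions `η` merge. -/
def doubleParameters : Set ℝ := {η | Real.tan η = η}

/-- The number of CR-geodesics from `1` to `Q`, those with `tan η = η` being counted twice. -/
def crGeodesicCount {n : ℕ} (t : ℝ) (Q : CSpace n) (W : Set ℝ) : ℕ :=
  (crGeodesics t Q W).ncard + (crGeodesics t Q (W ∩ doubleParameters)).ncard

/-- The Euclidean length of a curve over `[0, t]`. -/
def curveLength {n : ℕ} (t : ℝ) (z : ℝ → CSpace n) : ℝ := ∫ s in (0 : ℝ)..t, ‖deriv z s‖

end

/-! Along a bicharacteristic `⟪z, p⟫ = iτ` and `‖p‖ = Ω` are conserved, so Hamilton's equations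
become linear with constant coefficients, and for `Ω ≠ 0` the solution from `1` is `e^{-iτs}
(cos(Ωs) 1 + sin(Ωs)/Ω p(0))` (`IsCRBicharacteristic.eq_crCurve`). With `σ = τ/Ω`, its first
coordinate is a point `cos x + iσ sin x`, `x = Ωs`, of an ellipse, turned back by the angle `σx`.
For `σ > 0` the angle of the ellipse minus `σx` is continuous and nondecreasing; hence such a curve
is local exactly when the prescribed final angle is the value of this lift (`isLocalAngle_crFirst`,
`IsLocalAngle.eq_of_crFirst`). Conjugation handles `σ < 0`, and `σ = 0` is treated directly.

Let `c = |z₁(Q)| < 1` and `ψ = |φ₁(Q)|`. Then `sin η ≠ 0`, so `Q`, `η` and `σ` determine `p(0)`, and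
only the first coordinate of the endpoint matters. Put `η = kπ + y` with `0 < y < π`. The condition
on the modulus says `cos y + iσ sin y = c e^{ia}` (for `σ ≥ 0`), which makes `y` and `σ` functions
of `a ∈ [0, π]`. What remains is `F_k(a) = kπ + a - ση = ψ`, where `F_k` is `turnPhase`; the sign of
`σ` is that of `φ₁(Q)`.

The derivative of `F_k` has the sign of `sin y - η cos y`, so its critical points are those with
`tan η = η` (`hasDerivAt_turnPhase`). This quantity increases with `y`, and `y` increases with `a`
when `c > 0`; thus `F_k` has at most one valley, between the end values `kπ` and `(k+1)π`. `F_0`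
increases from `0` to `π` and gives exactly one solution. For every other admissible `k` one has `ψ
< kπ`, and the level `ψ` is met an even number of times, tangency counting twice
(`even_ncard_level_of_valley`). A lower bound for `F_k` leaves finitely many `k`, so the total is
odd. If `arccos c ≥ η₁ - π`, then `F_1` is increasing and `c < 1/3`, which excludes all `k ≥ 1`.

If `c = 1` and `Q ≠ 1`, every `η = kπ` with `k ≥ 2` works: since `sin η = 0`, the part of `p(0)`
orthogonal to `1` does not affect the endpoint, and `τ` can be chosen to give the right angle. The
resulting lengths are `√(2kπψ - ψ²)`, all different. -/

noncomputable section

/-! ### Explicit bicharacteristics starting at the base point -/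

/-- The curve `e^{-iτs} (cos(Ωs) 1 + sin(Ωs)/Ω v)`. -/
def crCurve {n : ℕ} (τ Ω : ℝ) (v : CSpace n) (s : ℝ) : CSpace n :=
  Complex.exp (-(Complex.I * (τ * s : ℝ))) •
    (((Real.cos (Ω * s) : ℝ) : ℂ) • basePoint n + ((Real.sin (Ω * s) / Ω : ℝ) : ℂ) • v)

/-- The momentum `e^{-iτs} (-Ω sin(Ωs) 1 + cos(Ωs) v)` along `crCurve τ Ω v`. -/
def crMomentum {n : ℕ} (τ Ω : ℝ) (v : CSpace n) (s : ℝ) : CSpace n :=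
  Complex.exp (-(Complex.I * (τ * s : ℝ))) •
    (((-(Ω * Real.sin (Ω * s)) : ℝ) : ℂ) • basePoint n + ((Real.cos (Ω * s) : ℝ) : ℂ) • v)

theorem norm_basePoint (n : ℕ) : ‖basePoint n‖ = 1 := by
  simp [basePoint]

theorem basePoint_zero (n : ℕ) : basePoint n 0 = 1 := by
  simp [basePoint]

theorem inner_basePoint {n : ℕ} (v : CSpace n) : inner ℂ (basePoint n) v = v 0 := by
  simp [basePoint, EuclideanSpace.inner_single_left]

theorem crCurve_zero {n : ℕ} (τ Ω : ℝ) (v : CSpace n) : crCurve τ Ω v 0 = basePoint n := by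
  simp [crCurve]

theorem crMomentum_zero {n : ℕ} (τ Ω : ℝ) (v : CSpace n) : crMomentum τ Ω v 0 = v := by
  simp [crMomentum]

theorem norm_exp_neg_I_mul (x : ℝ) : ‖Complex.exp (-(Complex.I * (x : ℝ)))‖ = 1 := by
  rw [← mul_neg, ← Complex.ofReal_neg, mul_comm, Complex.norm_exp_ofReal_mul_I]

theorem hasDerivAt_exp_neg_I_mul (τ s : ℝ) :
    HasDerivAt (fun s : ℝ => Complex.exp (-(Complex.I * (τ * s : ℝ))))
      (-(Complex.I * τ) * Complex.exp (-(Complex.I * (τ * s : ℝ)))) s := by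
  have h1 : HasDerivAt (fun s : ℝ => ((τ * s : ℝ) : ℂ)) (τ : ℂ) s := by
    simpa using ((hasDerivAt_id s).const_mul τ).ofReal_comp
  have h := ((h1.const_mul Complex.I).neg).cexp
  exact h.congr_deriv (by simp only [Pi.neg_apply]; ring)

theorem hasDerivAt_cos_mul (Ω s : ℝ) :
    HasDerivAt (fun s : ℝ => ((Real.cos (Ω * s) : ℝ) : ℂ)) ((-(Ω * Real.sin (Ω * s)) : ℝ) : ℂ) s := by
  have h := (((hasDerivAt_id s).const_mul Ω).cos).ofReal_comp
  exact h.congr_deriv (by simp; ring)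

theorem hasDerivAt_sin_mul (Ω s : ℝ) :
    HasDerivAt (fun s : ℝ => ((Real.sin (Ω * s) : ℝ) : ℂ)) ((Ω * Real.cos (Ω * s) : ℝ) : ℂ) s := by
  have h := (((hasDerivAt_id s).const_mul Ω).sin).ofReal_comp
  exact h.congr_deriv (by simp; ring)

section Explicit

variable {n : ℕ} {τ Ω : ℝ} {v : CSpace n}

theorem inner_crCurve_crMomentum (hΩ : Ω ≠ 0) (hv0 : v 0 = Complex.I * τ) (hv : ‖v‖ = Ω) (s : ℝ) :
    inner ℂ (crCurve τ Ω v s) (crMomentum τ Ω v s) = Complex.I * τ := by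
  have hvv : inner ℂ v v = (Ω : ℂ) ^ 2 := by
    rw [inner_self_eq_norm_sq_to_K, hv]; rfl
  have hev : inner ℂ (basePoint n) v = Complex.I * τ := by rw [inner_basePoint, hv0]
  have hve : inner ℂ v (basePoint n) = -(Complex.I * τ) := by
    rw [← inner_conj_symm, hev]; simp
  have hee : inner ℂ (basePoint n) (basePoint n) = (1 : ℂ) := by
    rw [inner_basePoint, basePoint_zero]
  have hexp : (starRingEnd ℂ) (Complex.exp (-(Complex.I * (τ * s : ℝ)))) *
      Complex.exp (-(Complex.I * (τ * s : ℝ))) = 1 := by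
    rw [← Complex.normSq_eq_conj_mul_self, Complex.normSq_eq_norm_sq, norm_exp_neg_I_mul]; simp
  have hcs : ((Real.cos (Ω * s) : ℝ) : ℂ) ^ 2 + ((Real.sin (Ω * s) : ℝ) : ℂ) ^ 2 = 1 := by
    exact_mod_cast Real.cos_sq_add_sin_sq (Ω * s)
  have hΩ' : (Ω : ℂ) ≠ 0 := by exact_mod_cast hΩ
  unfold crCurve crMomentum
  rw [inner_smul_left, inner_smul_right, ← mul_assoc, hexp, one_mul]
  simp only [inner_add_left, inner_add_right, inner_smul_left, inner_smul_right, hvv, hev, hve, hee,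
    Complex.conj_ofReal]
  push_cast
  push_cast at hcs
  field_simp
  linear_combination (Complex.I * τ) * hcs

theorem norm_crCurve (hΩ : Ω ≠ 0) (hv0 : v 0 = Complex.I * τ) (hv : ‖v‖ = Ω) (s : ℝ) :
    ‖crCurve τ Ω v s‖ = 1 := by
  have hev : inner ℂ (basePoint n) v = Complex.I * τ := by rw [inner_basePoint, hv0]
  unfold crCurve
  rw [norm_smul, norm_exp_neg_I_mul, one_mul]
  have h : ‖((Real.cos (Ω * s) : ℝ) : ℂ) • basePoint n + ((Real.sin (Ω * s) / Ω : ℝ) : ℂ) • v‖ ^ 2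
      = 1 := by
    rw [@norm_add_sq ℂ, inner_smul_left, inner_smul_right, norm_smul, norm_smul, hev, hv,
      norm_basePoint, Complex.norm_real, Complex.norm_real, mul_pow, mul_pow, Real.norm_eq_abs,
      Real.norm_eq_abs, sq_abs, sq_abs, div_pow, Complex.conj_ofReal, RCLike.re_eq_complex_re,
      Complex.re_ofReal_mul, Complex.re_ofReal_mul]
    simp only [Complex.mul_re, Complex.I_re, Complex.I_im, Complex.ofReal_re, Complex.ofReal_im]
    have e : (Real.sin (Ω * s)) ^ 2 / Ω ^ 2 * Ω ^ 2 = Real.sin (Ω * s) ^ 2 :=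
      div_mul_cancel₀ _ (pow_ne_zero 2 hΩ)
    linear_combination Real.cos_sq_add_sin_sq (Ω * s) + e
  nlinarith [norm_nonneg (((Real.cos (Ω * s) : ℝ) : ℂ) • basePoint n +
    ((Real.sin (Ω * s) / Ω : ℝ) : ℂ) • v)]

theorem norm_crMomentum (hv0 : v 0 = Complex.I * τ) (hv : ‖v‖ = Ω) (s : ℝ) :
    ‖crMomentum τ Ω v s‖ = Ω := by
  have hev : inner ℂ (basePoint n) v = Complex.I * τ := by rw [inner_basePoint, hv0]
  unfold crMomentum
  rw [norm_smul, norm_exp_neg_I_mul, one_mul]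
  have h : ‖((-(Ω * Real.sin (Ω * s)) : ℝ) : ℂ) • basePoint n + ((Real.cos (Ω * s) : ℝ) : ℂ) • v‖ ^ 2
      = Ω ^ 2 := by
    rw [@norm_add_sq ℂ, inner_smul_left, inner_smul_right, norm_smul, norm_smul, hev, hv,
      norm_basePoint, Complex.norm_real, Complex.norm_real, mul_pow, mul_pow, Real.norm_eq_abs,
      Real.norm_eq_abs, sq_abs, sq_abs, Complex.conj_ofReal, RCLike.re_eq_complex_re,
      Complex.re_ofReal_mul, Complex.re_ofReal_mul]
    simp only [Complex.mul_re, Complex.I_re, Complex.I_im, Complex.ofReal_re, Complex.ofReal_im]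
    linear_combination Ω ^ 2 * Real.cos_sq_add_sin_sq (Ω * s)
  have hΩ : 0 ≤ Ω := hv ▸ norm_nonneg v
  exact (pow_left_inj₀ (norm_nonneg _) hΩ two_ne_zero).1 h

theorem hasDerivAt_crCurve (hΩ : Ω ≠ 0) (s : ℝ) :
    HasDerivAt (crCurve τ Ω v)
      (crMomentum τ Ω v s - (Complex.I * τ) • crCurve τ Ω v s) s := by
  have h3 : HasDerivAt (fun s : ℝ => ((Real.sin (Ω * s) / Ω : ℝ) : ℂ))
      ((Real.cos (Ω * s) : ℝ) : ℂ) s := by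
    have h := (hasDerivAt_sin_mul Ω s).div_const (Ω : ℂ)
    have hΩ' : (Ω : ℂ) ≠ 0 := by exact_mod_cast hΩ
    simp only [← Complex.ofReal_div] at h
    exact h.congr_deriv (by rw [mul_div_cancel_left₀ _ hΩ])
  have h := (hasDerivAt_exp_neg_I_mul τ s).smul
    (((hasDerivAt_cos_mul Ω s).smul_const (basePoint n)).add (h3.smul_const v))
  refine h.congr_deriv ?_
  simp only [crMomentum, crCurve, Pi.add_apply]
  module

theorem hasDerivAt_crMomentum (s : ℝ) :
    HasDerivAt (crMomentum τ Ω v)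
      (-((Ω : ℂ) ^ 2) • crCurve τ Ω v s - (Complex.I * τ) • crMomentum τ Ω v s) s := by
  have h3 : HasDerivAt (fun s : ℝ => ((-(Ω * Real.sin (Ω * s)) : ℝ) : ℂ))
      (-((Ω : ℂ) ^ 2) * ((Real.cos (Ω * s) : ℝ) : ℂ)) s := by
    have h := ((hasDerivAt_sin_mul Ω s).const_mul (-(Ω : ℂ)))
    have e : (fun s : ℝ => ((-(Ω * Real.sin (Ω * s)) : ℝ) : ℂ)) =
      fun s : ℝ => -(Ω : ℂ) * ((Real.sin (Ω * s) : ℝ) : ℂ) := by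
      funext s; push_cast; ring
    rw [e]
    exact h.congr_deriv (by push_cast; ring)
  have h := (hasDerivAt_exp_neg_I_mul τ s).smul
    ((h3.smul_const (basePoint n)).add ((hasDerivAt_cos_mul Ω s).smul_const v))
  refine h.congr_deriv ?_
  have e : ((-(Ω * Real.sin (Ω * s)) : ℝ) : ℂ) =
      -((Ω : ℂ) ^ 2) * ((Real.sin (Ω * s) / Ω : ℝ) : ℂ) := by
    rcases eq_or_ne Ω 0 with h0 | h0
    · simp [h0]
    · have hΩ' : (Ω : ℂ) ≠ 0 := by exact_mod_cast h0
      push_cast; field_simp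
  simp only [crMomentum, crCurve, Pi.add_apply, e]
  module

theorem crHamiltonianGradP_crCurve (hΩ : Ω ≠ 0) (hv0 : v 0 = Complex.I * τ) (hv : ‖v‖ = Ω)
    (s : ℝ) : crHamiltonianGradP (crCurve τ Ω v s) (crMomentum τ Ω v s) =
      crMomentum τ Ω v s - (Complex.I * τ) • crCurve τ Ω v s := by
  rw [crHamiltonianGradP, norm_crCurve hΩ hv0 hv, inner_crCurve_crMomentum hΩ hv0 hv]
  simp

theorem isCRBicharacteristic_crCurve (hΩ : Ω ≠ 0) (hv0 : v 0 = Complex.I * τ) (hv : ‖v‖ = Ω)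
    (t : ℝ) : IsCRBicharacteristic t (crCurve τ Ω v) (crMomentum τ Ω v) where
  norm_eq s _ := norm_crCurve hΩ hv0 hv s
  tangent s _ := by rw [inner_crCurve_crMomentum hΩ hv0 hv]; simp
  deriv_z s _ := by
    rw [crHamiltonianGradP_crCurve hΩ hv0 hv]
    exact (hasDerivAt_crCurve hΩ s).hasDerivWithinAt
  deriv_p s _ := by
    refine ((hasDerivAt_crMomentum s).congr_deriv ?_).hasDerivWithinAt
    rw [crHamiltonianGradZ, norm_crMomentum hv0 hv, ← inner_conj_symm,
      inner_crCurve_crMomentum hΩ hv0 hv]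
    simp only [map_mul, Complex.conj_I, Complex.conj_ofReal]
    push_cast
    module

theorem crCurve_apply_zero (hv0 : v 0 = Complex.I * τ) (s : ℝ) :
    crCurve τ Ω v s 0 = Complex.exp (-(Complex.I * (τ * s : ℝ))) *
      (Real.cos (Ω * s) + Complex.I * (τ / Ω * Real.sin (Ω * s) : ℝ)) := by
  simp only [crCurve, PiLp.smul_apply, PiLp.add_apply, basePoint_zero, hv0, smul_eq_mul]
  push_cast
  ring

end Explicit

/-! ### Integration of Hamilton's equations -/

section Solve

variable {n : ℕ} {t : ℝ} {z p : ℝ → CSpace n}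

theorem constant_of_hasDerivWithinAt_zero {E : Type*} [NormedAddCommGroup E] [NormedSpace ℝ E]
    {f : ℝ → E} (h : ∀ s ∈ Set.Icc 0 t, HasDerivWithinAt f 0 (Set.Icc 0 t) s) :
    ∀ s ∈ Set.Icc 0 t, f s = f 0 := by
  refine constant_of_derivWithin_zero (fun s hs => (h s hs).differentiableWithinAt) fun s hs => ?_
  have hs' : s ∈ Set.Icc 0 t := ⟨hs.1, hs.2.le⟩
  exact (h s hs').derivWithin (uniqueDiffOn_Icc (hs.1.trans_lt hs.2) s hs')

namespace IsCRBicharacteristic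

theorem inner_eq_I_mul (h : IsCRBicharacteristic t z p) {s : ℝ} (hs : s ∈ Set.Icc 0 t) :
    inner ℂ (z s) (p s) = Complex.I * ((inner ℂ (z s) (p s)).im : ℝ) := by
  apply Complex.ext <;> simp [h.tangent s hs]

theorem gradP_eq (h : IsCRBicharacteristic t z p) {s : ℝ} (hs : s ∈ Set.Icc 0 t) :
    crHamiltonianGradP (z s) (p s) = p s - inner ℂ (z s) (p s) • z s := by
  simp [crHamiltonianGradP, h.norm_eq s hs]

theorem gradZ_eq (h : IsCRBicharacteristic t z p) {s : ℝ} (hs : s ∈ Set.Icc 0 t) :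
    -crHamiltonianGradZ (z s) (p s) =
      -((‖p s‖ : ℂ) ^ 2) • z s - inner ℂ (z s) (p s) • p s := by
  have h1 : inner ℂ (p s) (z s) = - inner ℂ (z s) (p s) := by
    rw [← inner_conj_symm, h.inner_eq_I_mul hs]; simp
  rw [crHamiltonianGradZ, h1]
  push_cast
  module

/-- With `w = ⟪z, p⟫`, the derivative is `-(w + conj w) w`, which vanishes because `w` is purely
imaginary. -/
theorem inner_const (h : IsCRBicharacteristic t z p) :
    ∀ s ∈ Set.Icc 0 t, inner ℂ (z s) (p s) = inner ℂ (z 0) (p 0) := by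
  refine constant_of_hasDerivWithinAt_zero fun s hs => ?_
  refine ((h.deriv_z s hs).inner ℂ (h.deriv_p s hs)).congr_deriv ?_
  have hzz : inner ℂ (z s) (z s) = (1 : ℂ) := by
    rw [inner_self_eq_norm_sq_to_K, h.norm_eq s hs]; simp
  have hpp : inner ℂ (p s) (p s) = (‖p s‖ : ℂ) ^ 2 := inner_self_eq_norm_sq_to_K _
  rw [h.gradP_eq hs, h.gradZ_eq hs, inner_sub_left, inner_sub_right, inner_smul_left,
    inner_smul_right, inner_smul_right, hzz, hpp, h.inner_eq_I_mul hs]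
  simp only [map_mul, Complex.conj_I, Complex.conj_ofReal]
  ring

theorem norm_p_const (h : IsCRBicharacteristic t z p) : ∀ s ∈ Set.Icc 0 t, ‖p s‖ = ‖p 0‖ := by
  have key : ∀ s ∈ Set.Icc 0 t, (inner ℂ (p s) (p s) : ℂ) = inner ℂ (p 0) (p 0) := by
    refine constant_of_hasDerivWithinAt_zero fun s hs => ?_
    refine ((h.deriv_p s hs).inner ℂ (h.deriv_p s hs)).congr_deriv ?_
    have hpz : inner ℂ (p s) (z s) = - inner ℂ (z s) (p s) := by
      rw [← inner_conj_symm, h.inner_eq_I_mul hs]; simp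
    rw [h.gradZ_eq hs, inner_sub_left, inner_sub_right, inner_smul_left, inner_smul_right,
      inner_smul_left, inner_smul_right, hpz, h.inner_eq_I_mul hs]
    simp only [map_mul, map_neg, map_pow, Complex.conj_I, Complex.conj_ofReal]
    ring
  intro s hs
  have := key s hs
  rw [inner_self_eq_norm_sq_to_K, inner_self_eq_norm_sq_to_K] at this
  have h2 : ‖p s‖ ^ 2 = ‖p 0‖ ^ 2 := by exact_mod_cast this
  exact (pow_left_inj₀ (norm_nonneg _) (norm_nonneg _) two_ne_zero).1 h2

theorem p_zero_apply (h : IsCRBicharacteristic t z p) (ht : 0 ≤ t) (h0 : z 0 = basePoint n) :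
    p 0 0 = Complex.I * ((p 0 0).im : ℝ) := by
  have := h.inner_eq_I_mul (Set.left_mem_Icc.2 ht)
  rwa [h0, inner_basePoint] at this

theorem eq_crCurve (h : IsCRBicharacteristic t z p) (ht : 0 ≤ t) (h0 : z 0 = basePoint n)
    (hp : p 0 ≠ 0) : ∀ s ∈ Set.Icc 0 t, z s = crCurve (p 0 0).im ‖p 0‖ (p 0) s := by
  set τ := (p 0 0).im with hτ
  set Ω := ‖p 0‖ with hΩ
  have hΩ0 : Ω ≠ 0 := norm_ne_zero_iff.2 hp
  have hΩ' : (Ω : ℂ) ≠ 0 := by exact_mod_cast hΩ0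
  have hi : ∀ s ∈ Set.Icc 0 t, inner ℂ (z s) (p s) = Complex.I * τ := fun s hs => by
    rw [h.inner_const s hs, h0, inner_basePoint, h.p_zero_apply ht h0]
  -- The factor `e^{iτs}`, which undoes the rotation of the solution.
  let e : ℝ → ℂ := fun s => Complex.exp (-(Complex.I * ((-τ) * s : ℝ)))
  have he : ∀ s, HasDerivAt e ((Complex.I * τ) * e s) s := fun s => by
    refine (hasDerivAt_exp_neg_I_mul (-τ) s).congr_deriv ?_
    simp only [e]; push_cast; ring
  let C : ℝ → ℂ := fun s => ((Real.cos (Ω * s) : ℝ) : ℂ)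
  let S : ℝ → ℂ := fun s => ((Real.sin (Ω * s) : ℝ) : ℂ)
  have hC : ∀ s, HasDerivAt C (-(Ω * S s)) s := fun s => by
    refine (hasDerivAt_cos_mul Ω s).congr_deriv ?_
    simp only [S]; push_cast; ring
  have hS : ∀ s, HasDerivAt S (Ω * C s) s := fun s => by
    refine (hasDerivAt_sin_mul Ω s).congr_deriv ?_
    simp only [C]; push_cast; ring
  have hz : ∀ s ∈ Set.Icc 0 t, HasDerivWithinAt z (p s - (Complex.I * τ) • z s) (Set.Icc 0 t) s :=
    fun s hs => (h.deriv_z s hs).congr_deriv (by rw [h.gradP_eq hs, hi s hs])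
  have hp' : ∀ s ∈ Set.Icc 0 t, HasDerivWithinAt p (-((Ω : ℂ) ^ 2) • z s - (Complex.I * τ) • p s)
      (Set.Icc 0 t) s :=
    fun s hs => (h.deriv_p s hs).congr_deriv (by
      rw [h.gradZ_eq hs, hi s hs, h.norm_p_const s hs])
  -- Variation of constants: applying the inverse of the linear flow to `(z, p)` gives two constant
  -- vectors, namely `1` and `p 0`; solving for `z` recovers the formula.
  have k1 := constant_of_hasDerivWithinAt_zero (t := t)
    (f := fun s => (e s * C s) • z s - (e s * (S s / Ω)) • p s) (fun s hs => by
      refine ((((he s).mul (hC s)).hasDerivWithinAt.smul (hz s hs)).sub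
        (((he s).mul ((hS s).div_const (Ω : ℂ))).hasDerivWithinAt.smul (hp' s hs))).congr_deriv ?_
      simp only [Pi.mul_apply]
      match_scalars <;> field_simp <;> ring)
  have k2 := constant_of_hasDerivWithinAt_zero (t := t)
    (f := fun s => (e s * (Ω * S s)) • z s + (e s * C s) • p s) (fun s hs => by
      refine ((((he s).mul ((hS s).const_mul (Ω : ℂ))).hasDerivWithinAt.smul (hz s hs)).add
        (((he s).mul (hC s)).hasDerivWithinAt.smul (hp' s hs))).congr_deriv ?_
      simp only [Pi.mul_apply]
      match_scalars <;> ring)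
  intro s hs
  have a1 := k1 s hs
  have a2 := k2 s hs
  have e0 : e 0 = 1 := by simp [e]
  have C0 : C 0 = 1 := by simp [C]
  have S0 : S 0 = 0 := by simp [S]
  simp only [e0, C0, S0, h0] at a1 a2
  have hcs : C s ^ 2 + S s ^ 2 = 1 := by
    simp only [C, S]; exact_mod_cast Real.cos_sq_add_sin_sq (Ω * s)
  have hee : Complex.exp (-(Complex.I * (τ * s : ℝ))) * e s = 1 := by
    simp only [e]; rw [← Complex.exp_add]; simp
  have hsd : ((Real.sin (Ω * s) / Ω : ℝ) : ℂ) = S s / Ω := by simp [S]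
  unfold crCurve
  rw [hsd]
  change z s = Complex.exp (-(Complex.I * (τ * s : ℝ))) • (C s • basePoint n + (S s / Ω) • p 0)
  have b1 : basePoint n = (e s * C s) • z s - (e s * (S s / Ω)) • p s := by
    rw [a1]; simp
  have b2 : p 0 = (e s * (Ω * S s)) • z s + (e s * C s) • p s := by
    rw [a2]; simp
  rw [b1, b2]
  generalize Complex.exp (-(Complex.I * (τ * s : ℝ))) = e' at hee ⊢
  match_scalars
  · field_simp
    linear_combination -(C s ^ 2 + S s ^ 2) * hee - hcs
  · field_simp
    ring

theorem const_of_p_eq_zero (h : IsCRBicharacteristic t z p) (hp : p 0 = 0) :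
    ∀ s ∈ Set.Icc 0 t, z s = z 0 := by
  refine constant_of_hasDerivWithinAt_zero fun s hs => ?_
  have hps : p s = 0 := by
    rw [← norm_eq_zero, h.norm_p_const s hs, hp, norm_zero]
  exact (h.deriv_z s hs).congr_deriv (by rw [h.gradP_eq hs, hps]; simp)

end IsCRBicharacteristic

/-- The curve determines its initial momentum, as long as the latter is not a multiple of `1`. -/
theorem crCurve_injective (ht : 0 < t) {τ Ω τ' Ω' : ℝ} {v v' : CSpace n}
    (hΩ : Ω ≠ 0) (hΩ' : Ω' ≠ 0) {j : Fin (n + 1)} (hj : j ≠ 0) (hvj : v j ≠ 0)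
    (heq : ∀ s ∈ Set.Icc 0 t, crCurve τ Ω v s = crCurve τ' Ω' v' s) :
    τ = τ' ∧ v = v' := by
  have hb : basePoint n j = 0 := by simp [basePoint, hj]
  have hd : ∀ s ∈ Set.Icc 0 t, crMomentum τ Ω v s - (Complex.I * τ) • crCurve τ Ω v s =
      crMomentum τ' Ω' v' s - (Complex.I * τ') • crCurve τ' Ω' v' s := fun s hs =>
    (uniqueDiffOn_Icc ht s hs).eq_deriv _ (hasDerivAt_crCurve hΩ s).hasDerivWithinAt
      ((hasDerivAt_crCurve hΩ' s).hasDerivWithinAt.congr heq (heq s hs))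
  have h0 : (0 : ℝ) ∈ Set.Icc 0 t := Set.left_mem_Icc.2 ht.le
  have hd2 := (uniqueDiffOn_Icc ht 0 h0).eq_deriv _
    ((hasDerivAt_crMomentum 0).sub ((hasDerivAt_crCurve hΩ 0).const_smul
      (Complex.I * (τ : ℂ)))).hasDerivWithinAt
    (((hasDerivAt_crMomentum 0).sub ((hasDerivAt_crCurve hΩ' 0).const_smul
      (Complex.I * (τ' : ℂ)))).hasDerivWithinAt.congr hd (hd 0 h0))
  have hd1 := congrArg (fun w : CSpace n => w j) (hd 0 h0)
  have hd2 := congrArg (fun w : CSpace n => w j) hd2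
  simp only [crCurve_zero, crMomentum_zero, PiLp.sub_apply, PiLp.smul_apply, hb, smul_eq_mul,
    mul_zero, sub_zero, zero_sub] at hd1 hd2
  rw [← hd1] at hd2
  have : (2 * Complex.I * v j) * ((τ : ℂ) - τ') = 0 := by linear_combination -hd2
  have h3 : (τ : ℂ) - τ' = 0 := by
    refine (mul_eq_zero.1 this).resolve_left ?_
    simp [hvj]
  have h4 : τ = τ' := by exact_mod_cast sub_eq_zero.1 h3
  refine ⟨h4, ?_⟩
  have h5 := hd 0 h0
  rw [crMomentum_zero, crMomentum_zero, crCurve_zero, crCurve_zero, h4] at h5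
  exact sub_left_injective h5

end Solve

/-! ### The angle along an ellipse -/

/-- The continuous angle of `cos x + i σ sin x` for `0 < σ`, with value `0` at `x = 0`. -/
def ellipseAngle (σ x : ℝ) : ℝ :=
  x - Real.arctan ((1 - σ) * Real.sin (2 * x) / ((1 + σ) + (1 - σ) * Real.cos (2 * x)))

section Angle

variable {σ : ℝ}

theorem ellipseAngle_denom_pos (hσ : 0 < σ) (hσ1 : σ ≤ 1) (x : ℝ) :
    0 < (1 + σ) + (1 - σ) * Real.cos (2 * x) := by
  nlinarith [Real.neg_one_le_cos (2 * x)]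

/-- One has `cos x + iσ sin x = (e^{ix}/2) ((1+σ) + (1-σ) e^{-2ix})`. The last factor has positive
real part, so its argument is an arctangent without branch cuts; `r` is half its modulus. -/
theorem exists_cos_sin_ellipseAngle (hσ : 0 < σ) (hσ1 : σ ≤ 1) (x : ℝ) :
    ∃ r, 0 < r ∧ Real.cos x = r * Real.cos (ellipseAngle σ x) ∧
      σ * Real.sin x = r * Real.sin (ellipseAngle σ x) := by
  have hD := ellipseAngle_denom_pos hσ hσ1 x
  unfold ellipseAngle
  have hc2 : Real.cos (2 * x) = Real.cos x ^ 2 - Real.sin x ^ 2 := by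
    rw [Real.cos_two_mul']
  have hs2 := Real.sin_two_mul x
  set D := (1 + σ) + (1 - σ) * Real.cos (2 * x) with hDdef
  set w := (1 - σ) * Real.sin (2 * x) / D with hw
  have hwD : w * D = (1 - σ) * Real.sin (2 * x) := div_mul_cancel₀ _ hD.ne'
  have hq : 0 < Real.sqrt (1 + w ^ 2) := Real.sqrt_pos.2 (by positivity)
  have h1 := Real.cos_sq_add_sin_sq x
  refine ⟨D * Real.sqrt (1 + w ^ 2) / 2, by positivity, ?_, ?_⟩
  · rw [Real.cos_sub, Real.cos_arctan, Real.sin_arctan]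
    field_simp
    rw [hs2] at hwD
    rw [hc2] at hDdef
    linear_combination (-Real.sin x) * hwD - Real.cos x * hDdef - (1 - σ) * Real.cos x * h1
  · rw [Real.sin_sub, Real.cos_arctan, Real.sin_arctan]
    field_simp
    rw [hs2] at hwD
    rw [hc2] at hDdef
    linear_combination (Real.cos x) * hwD - Real.sin x * hDdef + (1 - σ) * Real.sin x * h1

theorem cos_add_I_mul_sin_eq (hσ : 0 < σ) (hσ1 : σ ≤ 1) (x : ℝ) :
    (Real.cos x + Complex.I * (σ * Real.sin x : ℝ) : ℂ) =
      (‖(Real.cos x + Complex.I * (σ * Real.sin x : ℝ) : ℂ)‖ : ℂ) *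
        Complex.exp (Complex.I * (ellipseAngle σ x : ℝ)) := by
  obtain ⟨r, hr, h1, h2⟩ := exists_cos_sin_ellipseAngle hσ hσ1 x
  have e : (Real.cos x + Complex.I * (σ * Real.sin x : ℝ) : ℂ) =
      r * Complex.exp (Complex.I * (ellipseAngle σ x : ℝ)) := by
    rw [h1, h2, mul_comm Complex.I (ellipseAngle σ x : ℂ), Complex.exp_mul_I]
    push_cast
    ring
  rw [e, norm_mul, mul_comm Complex.I (ellipseAngle σ x : ℂ), Complex.norm_exp_ofReal_mul_I,
    Complex.norm_real, Real.norm_of_nonneg hr.le, mul_one]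

theorem ellipseAngle_deriv_denom_pos (hσ : 0 < σ) (hσ1 : σ ≤ 1) (x : ℝ) :
    0 < 1 + σ ^ 2 + (1 - σ ^ 2) * Real.cos (2 * x) := by
  nlinarith [Real.neg_one_le_cos (2 * x), mul_nonneg (by linarith : 0 ≤ 1 - σ)
      (by linarith : 0 ≤ 1 + σ), sq_nonneg σ, mul_pos hσ hσ]

/-- The angle of the ellipse has derivative `σ / (cos² x + σ² sin² x)`. Subtracting `σ` and passing
to double angles gives a quotient that is visibly nonnegative. -/
theorem hasDerivAt_ellipseAngle (hσ : 0 < σ) (hσ1 : σ ≤ 1) (x : ℝ) :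
    HasDerivAt (fun x => ellipseAngle σ x - σ * x)
      ((1 - σ) * σ * (1 + σ) * (1 - Real.cos (2 * x)) /
        (1 + σ ^ 2 + (1 - σ ^ 2) * Real.cos (2 * x))) x := by
  have hD := ellipseAngle_denom_pos hσ hσ1 x
  have h2 : HasDerivAt (fun x : ℝ => 2 * x) 2 x := by simpa using (hasDerivAt_id x).const_mul 2
  have hN := h2.sin.const_mul (1 - σ)
  have hDd := (h2.cos.const_mul (1 - σ)).const_add (1 + σ)
  have h := (((hasDerivAt_id x).sub ((hN.div hDd hD.ne').arctan)).sub
    ((hasDerivAt_id x).const_mul σ))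
  refine h.congr_deriv ?_
  have h1 := Real.cos_sq_add_sin_sq (2 * x)
  have hE := ellipseAngle_deriv_denom_pos hσ hσ1 x
  rw [Pi.div_apply]
  clear h hN hDd h2
  have hs : Real.sin (2 * x) ^ 2 = 1 - Real.cos (2 * x) ^ 2 := by linarith
  generalize Real.cos (2 * x) = C at *
  generalize Real.sin (2 * x) = S at *
  have hF : ((1 + σ) + (1 - σ) * C) ^ 2 + ((1 - σ) * S) ^ 2 =
      2 * (1 + σ ^ 2 + (1 - σ ^ 2) * C) := by
    rw [mul_pow, hs]; ring
  have e1 : 1 + ((1 - σ) * S / ((1 + σ) + (1 - σ) * C)) ^ 2 =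
      2 * (1 + σ ^ 2 + (1 - σ ^ 2) * C) / ((1 + σ) + (1 - σ) * C) ^ 2 := by
    rw [← hF]; field_simp
  have e2 : ∀ D E X : ℝ, 0 < D → 0 < E → 1 / (2 * E / D ^ 2) * (X / D ^ 2) = X / (2 * E) :=
    fun D E X hD hE => by field_simp
  rw [e1, e2 _ _ _ hD hE]
  obtain ⟨E, hEdef⟩ : ∃ E, E = 1 + σ ^ 2 + (1 - σ ^ 2) * C := ⟨_, rfl⟩
  rw [← hEdef] at hE ⊢
  field_simp
  linear_combination (-(1 - σ) ^ 2) * hs + (1 - σ) * hEdef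

theorem monotone_ellipseAngle_sub (hσ : 0 < σ) (hσ1 : σ ≤ 1) :
    Monotone fun x => ellipseAngle σ x - σ * x := by
  refine monotone_of_hasDerivAt_nonneg (fun x => hasDerivAt_ellipseAngle hσ hσ1 x) fun x => ?_
  have := ellipseAngle_deriv_denom_pos hσ hσ1 x
  have h2 := Real.cos_le_one (2 * x)
  have h3 : 0 ≤ 1 - σ := by linarith
  have h4 : 0 ≤ 1 - Real.cos (2 * x) := by linarith
  exact div_nonneg (by positivity) this.le

theorem strictMono_ellipseAngle (hσ : 0 < σ) (hσ1 : σ ≤ 1) : StrictMono (ellipseAngle σ) := by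
  intro x y hxy
  have := monotone_ellipseAngle_sub hσ hσ1 hxy.le
  simp only at this
  nlinarith

theorem continuous_ellipseAngle_sub (hσ : 0 < σ) (hσ1 : σ ≤ 1) :
    Continuous fun x => ellipseAngle σ x - σ * x :=
  continuous_iff_continuousAt.2 fun x => (hasDerivAt_ellipseAngle hσ hσ1 x).continuousAt

theorem ellipseAngle_nat_mul_pi (k : ℕ) : ellipseAngle σ (k * Real.pi) = k * Real.pi := by
  have : Real.sin (2 * (k * Real.pi)) = 0 := by
    have := Real.sin_nat_mul_pi (2 * k)
    push_cast at this
    rwa [mul_assoc] at this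
  simp [ellipseAngle, this]

theorem ellipseAngle_zero : ellipseAngle σ 0 = 0 := by simp [ellipseAngle]

/-- This strictness makes the sign of `σ` agree with the sign of the final angle. If the
nondecreasing function vanished at `x`, it would be constant on `(0, x)`, against a positive
derivative. -/
theorem ellipseAngle_sub_pos (hσ : 0 < σ) (hσ1 : σ < 1) {x : ℝ} (hx : 0 < x) :
    0 < ellipseAngle σ x - σ * x := by
  have hm := monotone_ellipseAngle_sub hσ hσ1.le
  have h0 : ellipseAngle σ 0 - σ * 0 = 0 := by simp [ellipseAngle_zero]
  by_contra! hle
  have hconst : ∀ y ∈ Set.Ioo 0 x, ellipseAngle σ y - σ * y = 0 := fun y hy => by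
    have a := hm hy.1.le
    have b := hm hy.2.le
    simp only at a b
    linarith
  -- A point of `(0, x)` with `0 < 2y ≤ π`, so that `cos(2y) < 1`.
  set y := min x Real.pi / 2 with hy
  have hp := Real.pi_pos
  have hmin : 0 < min x Real.pi := lt_min hx hp
  have hyx : y ∈ Set.Ioo 0 x := ⟨by positivity, by have := min_le_left x Real.pi; linarith⟩
  have hypi : 2 * y ≤ Real.pi := by have := min_le_right x Real.pi; linarith
  have hd := (hasDerivAt_ellipseAngle hσ hσ1.le y)
  have hd0 : HasDerivAt (fun x => ellipseAngle σ x - σ * x) 0 y :=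
    (hasDerivAt_const y (0 : ℝ)).congr_of_eventuallyEq
      (Filter.eventually_of_mem (isOpen_Ioo.mem_nhds hyx) hconst)
  have he := hd.unique hd0
  have hpos := ellipseAngle_deriv_denom_pos hσ hσ1.le y
  have hc : Real.cos (2 * y) < 1 := by
    have := Real.cos_lt_cos_of_nonneg_of_le_pi le_rfl hypi (by linarith [hyx.1] : 0 < 2 * y)
    simpa using this
  have : 0 < (1 - σ) * σ * (1 + σ) * (1 - Real.cos (2 * y)) /
      (1 + σ ^ 2 + (1 - σ ^ 2) * Real.cos (2 * y)) := by
    have h3 : 0 < 1 - σ := by linarith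
    have h4 : 0 < 1 - Real.cos (2 * y) := by linarith
    positivity
  linarith

theorem ellipseAngle_mem_Icc (hσ : 0 < σ) (hσ1 : σ ≤ 1) (k : ℕ) {y : ℝ}
    (hy : y ∈ Set.Icc 0 Real.pi) :
    ellipseAngle σ (k * Real.pi + y) - k * Real.pi ∈ Set.Icc 0 Real.pi := by
  have hm := (strictMono_ellipseAngle hσ hσ1).monotone
  have h1 := ellipseAngle_nat_mul_pi (σ := σ) k
  have h2 := ellipseAngle_nat_mul_pi (σ := σ) (k + 1)
  have h3 := hm (show k * Real.pi ≤ k * Real.pi + y by linarith [hy.1])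
  have h4 := hm (show k * Real.pi + y ≤ (k + 1 : ℕ) * Real.pi by push_cast; linarith [hy.2])
  push_cast at h2 h4
  constructor <;> linarith

end Angle

/-! ### Locality of the first coordinate -/

/-- The first coordinate `e^{-iτs} (cos(Ωs) + i (τ/Ω) sin(Ωs))` of a CR-geodesic. -/
def crFirst (τ Ω s : ℝ) : ℂ :=
  Complex.exp (-(Complex.I * (τ * s : ℝ))) *
    (Real.cos (Ω * s) + Complex.I * (τ / Ω * Real.sin (Ω * s) : ℝ))

/-- Reduces negative `τ` to positive `τ`. -/
theorem crFirst_neg (τ Ω s : ℝ) : crFirst (-τ) Ω s = (starRingEnd ℂ) (crFirst τ Ω s) := by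
  simp only [crFirst, map_mul, ← Complex.exp_conj, map_add, map_neg, Complex.conj_I,
    Complex.conj_ofReal]
  congr 2
  · push_cast; ring
  · push_cast; ring

theorem norm_crFirst (τ Ω s : ℝ) : ‖crFirst τ Ω s‖ =
    ‖(Real.cos (Ω * s) + Complex.I * (τ / Ω * Real.sin (Ω * s) : ℝ) : ℂ)‖ := by
  rw [crFirst, norm_mul, norm_exp_neg_I_mul, one_mul]

theorem crFirst_eq_of_pos {τ Ω : ℝ} (hΩ : 0 < Ω) (hτ : 0 < τ) (hτΩ : τ ≤ Ω) (s : ℝ) :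
    crFirst τ Ω s = (‖crFirst τ Ω s‖ : ℂ) * Complex.exp (Complex.I *
      ((ellipseAngle (τ / Ω) (Ω * s) - τ / Ω * (Ω * s) : ℝ) : ℂ)) := by
  have h := cos_add_I_mul_sin_eq (div_pos hτ hΩ) ((div_le_one hΩ).2 hτΩ) (Ω * s)
  rw [norm_crFirst]
  set N := ‖(Real.cos (Ω * s) + Complex.I * (τ / Ω * Real.sin (Ω * s) : ℝ) : ℂ)‖
  rw [crFirst, h, mul_left_comm, ← Complex.exp_add]
  congr 2
  have : τ / Ω * (Ω * s) = τ * s := by field_simp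
  rw [this]
  push_cast
  ring

/-- Locality of a scalar curve with prescribed final angle `ψ`. -/
def IsLocalAngle (t ψ : ℝ) (f : ℝ → ℂ) : Prop :=
  ∃ φ : ℝ → ℝ, (MonotoneOn φ (Set.Icc 0 t) ∨ AntitoneOn φ (Set.Icc 0 t)) ∧
    φ 0 = 0 ∧ φ t = ψ ∧
    ∀ s ∈ Set.Icc 0 t, f s = (‖f s‖ : ℂ) * Complex.exp (Complex.I * (φ s : ℂ))

theorem IsLocalAngle.conj {t ψ : ℝ} {f : ℝ → ℂ} (h : IsLocalAngle t ψ f) :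
    IsLocalAngle t (-ψ) (fun s => (starRingEnd ℂ) (f s)) := by
  obtain ⟨φ, hm, h0, ht, hf⟩ := h
  refine ⟨fun s => -φ s, hm.symm.imp (fun h => h.neg) (fun h => h.neg), by simp [h0],
    by simp [ht], fun s hs => ?_⟩
  dsimp only
  conv_lhs => rw [hf s hs]
  simp only [map_mul, ← Complex.exp_conj, Complex.conj_I, Complex.conj_ofReal, RCLike.norm_conj]
  push_cast
  ring_nf

theorem isLocalAngle_crFirst {τ Ω t : ℝ} (hΩ : 0 < Ω) (hτ : 0 < τ) (hτΩ : τ ≤ Ω) :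
    IsLocalAngle t (ellipseAngle (τ / Ω) (Ω * t) - τ / Ω * (Ω * t)) (crFirst τ Ω) := by
  refine ⟨fun s => ellipseAngle (τ / Ω) (Ω * s) - τ / Ω * (Ω * s), Or.inl ?_, ?_, rfl,
    fun s _ => crFirst_eq_of_pos hΩ hτ hτΩ s⟩
  · intro x _ y _ hxy
    exact monotone_ellipseAngle_sub (div_pos hτ hΩ) ((div_le_one hΩ).2 hτΩ)
      (mul_le_mul_of_nonneg_left hxy hΩ.le)
  · simp [ellipseAngle_zero]

theorem eq_of_exp_I_mul_eq {x y : ℝ}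
    (h : Complex.exp (Complex.I * (x : ℂ)) = Complex.exp (Complex.I * (y : ℂ)))
    (hxy : |x - y| < 2 * Real.pi) : x = y := by
  rw [Complex.exp_eq_exp_iff_exists_int] at h
  obtain ⟨m, hm⟩ := h
  have hm' : x = y + m * (2 * Real.pi) := by
    have : Complex.I * (x : ℂ) = Complex.I * ((y + m * (2 * Real.pi) : ℝ) : ℂ) := by
      rw [hm]; push_cast; ring
    exact_mod_cast mul_left_cancel₀ Complex.I_ne_zero this
  have hpi := Real.pi_pos
  have : |(m : ℝ)| < 1 := by
    rw [hm', add_sub_cancel_left, abs_mul, abs_of_pos (by positivity : 0 < 2 * Real.pi)] at hxy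
    nlinarith
  have hm0 : m = 0 := by
    rw [← Int.cast_abs] at this
    have : |m| < 1 := by exact_mod_cast this
    exact Int.abs_lt_one_iff.1 this
  simp [hm', hm0]

/-- The first coordinate never vanishes here, so a monotone angle `φ` and the continuous lift `Φ`
differ pointwise by multiples of `2π`. Monotonicity confines `φ` between `0` and `ψ`, hence to `[-π,
π]`. A different final value is excluded by an intermediate time at which `Φ` and `φ` differ by less
than `2π` but cannot be equal. -/
theorem IsLocalAngle.eq_of_crFirst {τ Ω t ψ : ℝ} (ht : 0 ≤ t) (hΩ : 0 < Ω) (hτ : 0 < τ)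
    (hτΩ : τ ≤ Ω) (hψ : |ψ| ≤ Real.pi) (h : IsLocalAngle t ψ (crFirst τ Ω)) :
    ψ = ellipseAngle (τ / Ω) (Ω * t) - τ / Ω * (Ω * t) := by
  obtain ⟨φ, hm, h0, hφt, hf⟩ := h
  set Φ : ℝ → ℝ := fun s => ellipseAngle (τ / Ω) (Ω * s) - τ / Ω * (Ω * s) with hΦ
  have hσ := div_pos hτ hΩ
  have hσ1 := (div_le_one hΩ).2 hτΩ
  have hΦm : Monotone Φ := fun x y hxy =>
    monotone_ellipseAngle_sub hσ hσ1 (mul_le_mul_of_nonneg_left hxy hΩ.le)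
  have hΦc : Continuous Φ := (continuous_ellipseAngle_sub hσ hσ1).comp (by fun_prop)
  have hΦ0 : Φ 0 = 0 := by simp [hΦ, ellipseAngle_zero]
  have hpi := Real.pi_pos
  have hne : ∀ s, (‖crFirst τ Ω s‖ : ℂ) ≠ 0 := fun s => by
    obtain ⟨r, hr, h1, h2⟩ := exists_cos_sin_ellipseAngle hσ hσ1 (Ω * s)
    rw [Ne, Complex.ofReal_eq_zero, norm_eq_zero, crFirst, mul_eq_zero, not_or]
    refine ⟨Complex.exp_ne_zero _, fun hz => ?_⟩
    have hre := congrArg Complex.re hz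
    have him := congrArg Complex.im hz
    simp [-Complex.ofReal_cos, -Complex.ofReal_sin] at hre him
    rcases him with him | him
    · exact (him.elim hτ.ne' hΩ.ne').elim
    · have := Real.cos_sq_add_sin_sq (Ω * s)
      rw [hre, him] at this
      norm_num at this
  have hexp : ∀ s ∈ Set.Icc 0 t, Complex.exp (Complex.I * (φ s : ℂ)) =
      Complex.exp (Complex.I * (Φ s : ℂ)) := fun s hs =>
    mul_left_cancel₀ (hne s) ((hf s hs).symm.trans (crFirst_eq_of_pos hΩ hτ hτΩ s))
  have h0m : (0 : ℝ) ∈ Set.Icc 0 t := Set.left_mem_Icc.2 ht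
  have htm : t ∈ Set.Icc 0 t := Set.right_mem_Icc.2 ht
  have habs := abs_le.1 hψ
  have hivt : ∀ v, 0 ≤ v → v ≤ Φ t → ∃ s ∈ Set.Icc 0 t, Φ s = v := fun v hv0 hvt =>
    intermediate_value_Icc ht hΦc.continuousOn ⟨hΦ0.le.trans hv0, hvt⟩
  have hΦt : 0 ≤ Φ t := hΦ0 ▸ hΦm ht
  by_cases hle : Φ t ≤ Real.pi
  · rcases lt_or_ge (Φ t - ψ) (2 * Real.pi) with hlt | hge
    · rw [← hφt]
      refine eq_of_exp_I_mul_eq (hexp t htm) ?_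
      rw [hφt, abs_lt]
      constructor <;> linarith
    · have hψ' : ψ = -Real.pi := by linarith
      have hΦ' : Φ t = Real.pi := by linarith
      obtain ⟨s, hs, hsv⟩ := hivt (Real.pi / 2) (by positivity) (by linarith)
      exfalso
      have hφs : φ s ∈ Set.Icc (-Real.pi) 0 := by
        rcases hm with hm | hm
        · have := hm h0m htm ht; linarith
        · exact ⟨by have := hm hs htm hs.2; linarith, by have := hm h0m hs hs.1; linarith⟩
      have := eq_of_exp_I_mul_eq (hexp s hs) (by
        rw [hsv, abs_lt]; constructor <;> linarith [hφs.1, hφs.2])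
      linarith [hφs.2]
  · exfalso
    push Not at hle
    rcases hm with hm | hm
    -- At this time `π < Φ s ≤ 3π/2` while `0 ≤ φ s ≤ π`: too close to differ by a nonzero multiple
    -- of `2π`, yet distinct.
    · obtain ⟨s, hs, hsv⟩ := hivt (min (Φ t) (3 * Real.pi / 2))
        (le_min hΦt (by positivity)) (min_le_left _ _)
      have hv1 : Real.pi < Φ s := by rw [hsv]; exact lt_min hle (by linarith)
      have hv2 : Φ s ≤ 3 * Real.pi / 2 := by rw [hsv]; exact min_le_right _ _
      have h1 := hm h0m hs hs.1
      have h2 := hm hs htm hs.2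
      have := eq_of_exp_I_mul_eq (hexp s hs) (by rw [abs_lt]; constructor <;> linarith)
      linarith
    · obtain ⟨s, hs, hsv⟩ := hivt (Real.pi / 2) (by positivity) (by linarith)
      have h1 := hm h0m hs hs.1
      have h2 := hm hs htm hs.2
      have := eq_of_exp_I_mul_eq (hexp s hs) (by rw [abs_lt]; constructor <;> linarith)
      linarith

theorem crFirst_zero_left (Ω s : ℝ) : crFirst 0 Ω s = Real.cos (Ω * s) := by
  simp [crFirst]

theorem isLocalAngle_crFirst_zero {Ω t : ℝ} (hΩ : 0 ≤ Ω) (hη : Ω * t ≤ Real.pi) :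
    IsLocalAngle t (Complex.arg (crFirst 0 Ω t)) (crFirst 0 Ω) := by
  refine ⟨fun s => Complex.arg (crFirst 0 Ω s), Or.inl ?_, by simp [crFirst_zero_left], rfl,
    fun s _ => ?_⟩
  · intro x hx y hy hxy
    simp only [crFirst_zero_left]
    have hc : Real.cos (Ω * y) ≤ Real.cos (Ω * x) :=
      Real.cos_le_cos_of_nonneg_of_le_pi (mul_nonneg hΩ hx.1)
        ((mul_le_mul_of_nonneg_left hy.2 hΩ).trans hη) (mul_le_mul_of_nonneg_left hxy hΩ)
    rcases le_or_gt 0 (Real.cos (Ω * x)) with h | h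
    · rw [Complex.arg_ofReal_of_nonneg h]
      rcases le_or_gt 0 (Real.cos (Ω * y)) with h' | h'
      · rw [Complex.arg_ofReal_of_nonneg h']
      · rw [Complex.arg_ofReal_of_neg h']; exact Real.pi_pos.le
    · rw [Complex.arg_ofReal_of_neg h, Complex.arg_ofReal_of_neg (hc.trans_lt h)]
  · dsimp only
    rw [mul_comm Complex.I, Complex.norm_mul_exp_arg_mul_I]

/-- Here the first coordinate is `cos(Ωs)`. Final angle `0` forces `φ = 0` throughout, so the cosine
may not become negative. Final angle `π` forces `φ = π` from `Ωs = π` on, so the cosine may not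
become positive again. -/
theorem IsLocalAngle.zero_left {Ω t ψ : ℝ} (ht : 0 < t) (hΩ : 0 < Ω)
    (h : IsLocalAngle t ψ (crFirst 0 Ω)) :
    (ψ = 0 → Ω * t ≤ Real.pi / 2) ∧ (ψ = Real.pi → Ω * t ≤ 3 * Real.pi / 2) := by
  obtain ⟨φ, hm, h0, hφt, hf⟩ := h
  simp only [crFirst_zero_left, Complex.norm_real, Real.norm_eq_abs] at hf
  have hpi := Real.pi_pos
  have h0m : (0 : ℝ) ∈ Set.Icc 0 t := Set.left_mem_Icc.2 ht.le
  have htm : t ∈ Set.Icc 0 t := Set.right_mem_Icc.2 ht.le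
  have hval : ∀ v, 0 ≤ v → v ≤ Ω * t → ∃ s ∈ Set.Icc 0 t, Ω * s = v := fun v hv0 hvt =>
    ⟨v / Ω, ⟨by positivity, by rw [div_le_iff₀ hΩ]; linarith⟩, by field_simp⟩
  constructor
  · intro hψ
    by_contra! hlt
    obtain ⟨s, hs, hsv⟩ := hval (min (Ω * t) Real.pi) (by positivity) (min_le_left _ _)
    have hc : Real.cos (Ω * s) < 0 := by
      apply Real.cos_neg_of_pi_div_two_lt_of_lt
      · rw [hsv]; exact lt_min hlt (by linarith)
      · rw [hsv]; have := min_le_right (Ω * t) Real.pi; linarith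
    have hφs : φ s = 0 := by
      rcases hm with hm | hm
      · exact le_antisymm (by have := hm hs htm hs.2; linarith) (by have := hm h0m hs hs.1; linarith)
      · exact le_antisymm (by have := hm h0m hs hs.1; linarith) (by have := hm hs htm hs.2; linarith)
    have := hf s hs
    rw [hφs] at this
    simp only [Complex.ofReal_zero, mul_zero, Complex.exp_zero, mul_one] at this
    have : Real.cos (Ω * s) = |Real.cos (Ω * s)| := by exact_mod_cast this
    linarith [abs_nonneg (Real.cos (Ω * s))]
  · intro hψ
    by_contra! hlt
    have hmono : MonotoneOn φ (Set.Icc 0 t) := by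
      rcases hm with hm | hm
      · exact hm
      · have := hm h0m htm ht.le; linarith
    obtain ⟨s₁, hs₁, hsv₁⟩ := hval Real.pi hpi.le (by linarith)
    obtain ⟨s, hs, hsv⟩ := hval (min (Ω * t) (2 * Real.pi)) (by positivity) (min_le_left _ _)
    have hge : 3 * Real.pi / 2 < Ω * s := by rw [hsv]; exact lt_min hlt (by linarith)
    have hle : Ω * s ≤ 2 * Real.pi := by rw [hsv]; exact min_le_right _ _
    have hs₁s : s₁ ≤ s := by
      by_contra! h
      have := mul_lt_mul_of_pos_left h hΩ
      linarith
    have hφ₁ : φ s₁ = Real.pi := by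
      have h1 := hf s₁ hs₁
      rw [hsv₁, Real.cos_pi] at h1
      have h2 := hmono h0m hs₁ hs₁.1
      have h3 := hmono hs₁ htm hs₁.2
      refine eq_of_exp_I_mul_eq ?_ (by rw [abs_lt]; constructor <;> linarith)
      rw [mul_comm Complex.I (Real.pi : ℂ), Complex.exp_pi_mul_I]
      simpa using h1.symm
    have hφs : φ s = Real.pi :=
      le_antisymm (by have := hmono hs htm hs.2; linarith) (hφ₁ ▸ hmono hs₁ hs hs₁s)
    have hc : 0 < Real.cos (Ω * s) := by
      rw [← Real.cos_sub_two_pi]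
      exact Real.cos_pos_of_mem_Ioo ⟨by linarith, by linarith⟩
    have := hf s hs
    rw [hφs, mul_comm Complex.I (Real.pi : ℂ), Complex.exp_pi_mul_I, mul_neg, mul_one] at this
    have : Real.cos (Ω * s) = -|Real.cos (Ω * s)| := by exact_mod_cast this
    linarith [abs_nonneg (Real.cos (Ω * s))]

/-! ### The scalar functions `y(a)`, `σ(a)` and `F_k(a)` -/

/-- The angle `y ∈ [0, π]` with `cos y = c cos a`. -/
def turnAngle (c a : ℝ) : ℝ := Real.arccos (c * Real.cos a)

/-- The ratio `σ = τ/Ω` for which `cos y + i σ sin y = c e^{ia}`, where `y = turnAngle c a`. -/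
def turnRatio (c a : ℝ) : ℝ := c * Real.sin a / Real.sin (turnAngle c a)

/-- The final angle of the first coordinate of the geodesic with `η = kπ + turnAngle c a`. -/
def turnPhase (c : ℝ) (k : ℕ) (a : ℝ) : ℝ :=
  k * Real.pi + a - turnRatio c a * (k * Real.pi + turnAngle c a)

/-- A function of `y ∈ [0, π]` with the zeros of `tan η - η`, `η = kπ + y`. -/
def tanDefect (k : ℕ) (y : ℝ) : ℝ := Real.sin y - (k * Real.pi + y) * Real.cos y

section TanDefect

theorem hasDerivAt_tanDefect (k : ℕ) (y : ℝ) :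
    HasDerivAt (tanDefect k) ((k * Real.pi + y) * Real.sin y) y := by
  have h := (Real.hasDerivAt_sin y).sub
    (((hasDerivAt_id y).const_add (k * Real.pi)).mul (Real.hasDerivAt_cos y))
  exact h.congr_deriv (by simp)

theorem continuous_tanDefect (k : ℕ) : Continuous (tanDefect k) := by
  unfold tanDefect; fun_prop

theorem strictMonoOn_tanDefect (k : ℕ) : StrictMonoOn (tanDefect k) (Set.Icc 0 Real.pi) := by
  refine strictMonoOn_of_deriv_pos (convex_Icc _ _) (continuous_tanDefect k).continuousOn
    fun y hy => ?_
  rw [interior_Icc] at hy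
  rw [(hasDerivAt_tanDefect k y).deriv]
  have := Real.sin_pos_of_mem_Ioo hy
  have h1 : 0 ≤ k * Real.pi := by positivity
  have h2 := hy.1
  positivity

theorem tanDefect_zero (k : ℕ) : tanDefect k 0 = -(k * Real.pi) := by simp [tanDefect]

theorem tan_eq_self_iff (k : ℕ) {y : ℝ} (hy : y ∈ Set.Ioo 0 Real.pi) :
    Real.tan (k * Real.pi + y) = k * Real.pi + y ↔ tanDefect k y = 0 := by
  have hs := Real.sin_pos_of_mem_Ioo hy
  have hη : 0 < k * Real.pi + y := by
    have h1 : 0 ≤ k * Real.pi := by positivity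
    linarith [hy.1]
  have ht : Real.tan (k * Real.pi + y) = Real.tan y := by
    rw [add_comm]; exact_mod_cast Real.tan_add_nat_mul_pi y k
  rw [ht, Real.tan_eq_sin_div_cos, tanDefect, sub_eq_zero]
  -- Where the cosine vanishes, `Real.tan` has the value `0`, which is not the positive `η`; the
  -- defect is `sin y > 0` there, so both sides are false.
  rcases eq_or_ne (Real.cos y) 0 with h | h
  · rw [h, div_zero, mul_zero]
    constructor <;> intro h' <;> linarith
  · rw [div_eq_iff h]

theorem existsUnique_tan_eq_self :
    ∃! η : ℝ, η ∈ Set.Icc Real.pi (3 * Real.pi / 2) ∧ Real.tan η = η := by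
  have hpi := Real.pi_pos
  have key : ∀ η ∈ Set.Icc Real.pi (3 * Real.pi / 2), Real.tan η = η →
      η - Real.pi ∈ Set.Icc 0 Real.pi ∧ tanDefect 1 (η - Real.pi) = 0 := fun η hη h => by
    have hne : η ≠ Real.pi := by
      rintro rfl
      rw [Real.tan_pi] at h
      linarith
    have hlt : Real.pi < η := lt_of_le_of_ne hη.1 hne.symm
    refine ⟨⟨by linarith, by linarith [hη.2]⟩, ?_⟩
    refine (tan_eq_self_iff 1 ⟨by linarith, by linarith [hη.2]⟩).1 ?_
    simpa using h
  have h0 := tanDefect_zero 1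
  have h1 : tanDefect 1 (Real.pi / 2) = 1 := by simp [tanDefect]
  obtain ⟨y, hy, hy0⟩ := intermediate_value_Icc (by positivity : 0 ≤ Real.pi / 2)
    (continuous_tanDefect 1).continuousOn
    (show (0 : ℝ) ∈ Set.Icc (tanDefect 1 0) (tanDefect 1 (Real.pi / 2)) by
      rw [h0, h1]; constructor <;> norm_num; exact hpi.le)
  have hyne : y ≠ 0 := by
    rintro rfl
    rw [h0] at hy0
    norm_num at hy0
  have hypos : 0 < y := lt_of_le_of_ne hy.1 hyne.symm
  refine ⟨Real.pi + y, ⟨⟨by linarith, by linarith [hy.2]⟩, ?_⟩, fun η hη => ?_⟩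
  · have := (tan_eq_self_iff 1 (y := y) ⟨hypos, by linarith [hy.2]⟩).2 hy0
    simpa using this
  · obtain ⟨h2, h3⟩ := key η hη.1 hη.2
    have := (strictMonoOn_tanDefect 1).injOn h2 ⟨hy.1, by linarith [hy.2]⟩ (h3.trans hy0.symm)
    linarith

end TanDefect

section Turn

variable {c : ℝ}

theorem abs_mul_cos_lt_one (hc : 0 ≤ c) (hc1 : c < 1) (a : ℝ) : |c * Real.cos a| < 1 := by
  rw [abs_mul, abs_of_nonneg hc]
  nlinarith [Real.abs_cos_le_one a, abs_nonneg (Real.cos a)]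

theorem cos_turnAngle (hc : 0 ≤ c) (hc1 : c < 1) (a : ℝ) :
    Real.cos (turnAngle c a) = c * Real.cos a := by
  have := abs_lt.1 (abs_mul_cos_lt_one hc hc1 a)
  exact Real.cos_arccos this.1.le this.2.le

theorem turnAngle_mem_Ioo (hc : 0 ≤ c) (hc1 : c < 1) (a : ℝ) :
    turnAngle c a ∈ Set.Ioo 0 Real.pi := by
  have := abs_lt.1 (abs_mul_cos_lt_one hc hc1 a)
  refine ⟨Real.arccos_pos.2 this.2, lt_of_le_of_ne (Real.arccos_le_pi _) fun h => ?_⟩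
  rw [turnAngle, Real.arccos_eq_pi] at h
  linarith

theorem sin_turnAngle_pos (hc : 0 ≤ c) (hc1 : c < 1) (a : ℝ) : 0 < Real.sin (turnAngle c a) :=
  Real.sin_pos_of_mem_Ioo (turnAngle_mem_Ioo hc hc1 a)

theorem turnRatio_mul_sin (hc : 0 ≤ c) (hc1 : c < 1) (a : ℝ) :
    turnRatio c a * Real.sin (turnAngle c a) = c * Real.sin a :=
  div_mul_cancel₀ _ (sin_turnAngle_pos hc hc1 a).ne'

/-- Equivalent to `(1 - σ²) sin² y = 1 - c² > 0`. -/
theorem turnRatio_sq_lt_one (hc : 0 ≤ c) (hc1 : c < 1) (a : ℝ) : turnRatio c a ^ 2 < 1 := by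
  have h1 := turnRatio_mul_sin hc hc1 a
  have h2 := sin_turnAngle_pos hc hc1 a
  have h3 := cos_turnAngle hc hc1 a
  have h4 := Real.cos_sq_add_sin_sq a
  have h5 := Real.cos_sq_add_sin_sq (turnAngle c a)
  have h6 : turnRatio c a ^ 2 * Real.sin (turnAngle c a) ^ 2 <
      1 * Real.sin (turnAngle c a) ^ 2 := by
    rw [← mul_pow, h1]
    rw [h3] at h5
    have e : (c * Real.sin a) ^ 2 + (c * Real.cos a) ^ 2 = c ^ 2 := by
      linear_combination c ^ 2 * h4
    have : c ^ 2 < 1 := by nlinarith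
    linarith
  exact lt_of_mul_lt_mul_right h6 (sq_nonneg _)

theorem turnRatio_nonneg (hc : 0 ≤ c) (hc1 : c < 1) {a : ℝ} (ha : a ∈ Set.Icc 0 Real.pi) :
    0 ≤ turnRatio c a :=
  div_nonneg (mul_nonneg hc (Real.sin_nonneg_of_mem_Icc ha)) (sin_turnAngle_pos hc hc1 a).le

theorem turnRatio_lt_one (hc : 0 ≤ c) (hc1 : c < 1) (a : ℝ) : turnRatio c a < 1 := by
  nlinarith [turnRatio_sq_lt_one hc hc1 a]

/-- From `|cos y| = c |cos a| ≤ |cos a|` one gets `sin a ≤ sin y`. -/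
theorem turnRatio_le (hc : 0 ≤ c) (hc1 : c < 1) {a : ℝ} (ha : a ∈ Set.Icc 0 Real.pi) :
    turnRatio c a ≤ c := by
  have h0 := Real.sin_nonneg_of_mem_Icc ha
  have h2 := sin_turnAngle_pos hc hc1 a
  have h3 := cos_turnAngle hc hc1 a
  have h4 := Real.cos_sq_add_sin_sq a
  have h5 := Real.cos_sq_add_sin_sq (turnAngle c a)
  have h6 : Real.sin a ≤ Real.sin (turnAngle c a) := by
    rw [h3, mul_pow] at h5
    have : c ^ 2 * Real.cos a ^ 2 ≤ 1 * Real.cos a ^ 2 :=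
      mul_le_mul_of_nonneg_right (by nlinarith) (sq_nonneg _)
    exact (sq_le_sq₀ h0 h2.le).1 (by linarith)
  rw [turnRatio, div_le_iff₀ h2]
  exact mul_le_mul_of_nonneg_left h6 hc

theorem hasDerivAt_turnAngle (hc : 0 ≤ c) (hc1 : c < 1) (a : ℝ) :
    HasDerivAt (turnAngle c) (turnRatio c a) a := by
  have hb := abs_lt.1 (abs_mul_cos_lt_one hc hc1 a)
  have h := (Real.hasDerivAt_arccos hb.1.ne' hb.2.ne).comp a ((Real.hasDerivAt_cos a).const_mul c)
  refine h.congr_deriv ?_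
  rw [turnRatio, turnAngle, Real.sin_arccos]
  ring

theorem hasDerivAt_turnRatio (hc : 0 ≤ c) (hc1 : c < 1) (a : ℝ) :
    HasDerivAt (turnRatio c) ((1 - turnRatio c a ^ 2) * Real.cos (turnAngle c a) /
      Real.sin (turnAngle c a)) a := by
  have hs := sin_turnAngle_pos hc hc1 a
  have h := ((Real.hasDerivAt_sin a).const_mul c).div (hasDerivAt_turnAngle hc hc1 a).sin hs.ne'
  refine h.congr_deriv ?_
  rw [← cos_turnAngle hc hc1 a, ← turnRatio_mul_sin hc hc1 a]
  field_simp

/-- Differentiating `cos y = c cos a` and `σ sin y = c sin a` gives `y' = σ` and `σ' = (1 - σ²) cos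
y / sin y`. Hence `F_k' = 1 - σ² - ησ' = (1 - σ²)(1 - η cos y / sin y)`, whose zeros are those of
the defect. -/
theorem hasDerivAt_turnPhase (hc : 0 ≤ c) (hc1 : c < 1) (k : ℕ) (a : ℝ) :
    HasDerivAt (turnPhase c k)
      ((1 - turnRatio c a ^ 2) / Real.sin (turnAngle c a) * tanDefect k (turnAngle c a)) a := by
  have hs := sin_turnAngle_pos hc hc1 a
  have h := ((hasDerivAt_id a).const_add (k * Real.pi)).sub
    ((hasDerivAt_turnRatio hc hc1 a).mul
      ((hasDerivAt_turnAngle hc hc1 a).const_add (k * Real.pi)))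
  refine h.congr_deriv ?_
  rw [tanDefect]
  field_simp
  ring

theorem turnPhase_zero (k : ℕ) : turnPhase c k 0 = k * Real.pi := by
  simp [turnPhase, turnRatio]

theorem turnPhase_pi (k : ℕ) : turnPhase c k Real.pi = (k + 1) * Real.pi := by
  simp [turnPhase, turnRatio]; ring

theorem continuous_turnPhase (hc : 0 ≤ c) (hc1 : c < 1) (k : ℕ) : Continuous (turnPhase c k) :=
  continuous_iff_continuousAt.2 fun a => (hasDerivAt_turnPhase hc hc1 k a).continuousAt

theorem continuous_turnAngle (c : ℝ) : Continuous (turnAngle c) :=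
  Real.continuous_arccos.comp (by fun_prop)

theorem strictMonoOn_turnAngle (hc : 0 < c) (hc1 : c < 1) :
    StrictMonoOn (turnAngle c) (Set.Icc 0 Real.pi) := by
  intro a ha b hb hab
  have h1 := abs_lt.1 (abs_mul_cos_lt_one hc.le hc1 a)
  have h2 := abs_lt.1 (abs_mul_cos_lt_one hc.le hc1 b)
  exact Real.arccos_lt_arccos h2.1.le
    (mul_lt_mul_of_pos_left (Real.strictAntiOn_cos ha hb hab) hc) h1.2.le

theorem strictMonoOn_turnPhase (hc : 0 ≤ c) (hc1 : c < 1) {k : ℕ}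
    (h : ∀ a ∈ Set.Ioo 0 Real.pi, 0 < tanDefect k (turnAngle c a)) :
    StrictMonoOn (turnPhase c k) (Set.Icc 0 Real.pi) := by
  refine strictMonoOn_of_deriv_pos (convex_Icc _ _) (continuous_turnPhase hc hc1 k).continuousOn
    fun a ha => ?_
  rw [interior_Icc] at ha
  rw [(hasDerivAt_turnPhase hc hc1 k a).deriv]
  exact mul_pos (div_pos (by linarith [turnRatio_sq_lt_one hc hc1 a])
    (sin_turnAngle_pos hc hc1 a)) (h a ha)

/-- Since `c < 1`, this bound tends to infinity with `k`, so only finitely many `k` contribute to a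
given level. -/
theorem lower_bound_turnPhase (hc : 0 ≤ c) (hc1 : c < 1) (k : ℕ) {a : ℝ}
    (ha : a ∈ Set.Icc 0 Real.pi) :
    k * Real.pi - c * ((k + 1) * Real.pi) ≤ turnPhase c k a := by
  have h1 := turnRatio_le hc hc1 ha
  have h2 := turnAngle_mem_Ioo hc hc1 a
  have h3 : 0 ≤ k * Real.pi := by have := Real.pi_pos; positivity
  have h4 : turnRatio c a * (k * Real.pi + turnAngle c a) ≤ c * ((k + 1) * Real.pi) := by
    apply mul_le_mul h1 _ _ hc
    · linarith [h2.2]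
    · linarith [h2.1]
  unfold turnPhase
  linarith [ha.1]

end Turn

/-! ### Parity of the number of solutions -/

section Count

/-- A function on an interval whose derivative has the sign of a strictly increasing function, and
whose values at the ends exceed `ψ`, takes the value `ψ` an even number of times, where critical
points are counted twice. -/
theorem even_ncard_level_of_valley {f f' g : ℝ → ℝ} {A B ψ : ℝ} (hAB : A ≤ B)
    (hf : ∀ a, HasDerivAt f (f' a) a) (hsign : ∀ a, ∃ m, 0 < m ∧ f' a = m * g a)
    (hg : ContinuousOn g (Set.Icc A B)) (hmono : StrictMonoOn g (Set.Icc A B))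
    (hA : ψ < f A) (hB : ψ < f B) :
    {a ∈ Set.Icc A B | f a = ψ}.Finite ∧
      Even ({a ∈ Set.Icc A B | f a = ψ}.ncard + {a ∈ Set.Icc A B | f a = ψ ∧ g a = 0}.ncard) := by
  have hfc : Continuous f := continuous_iff_continuousAt.2 fun a => (hf a).continuousAt
  have hpos : ∀ {x y}, (∀ a ∈ Set.Ioo x y, 0 < g a) → StrictMonoOn f (Set.Icc x y) := by
    intro x y h
    refine strictMonoOn_of_deriv_pos (convex_Icc _ _) hfc.continuousOn fun a ha => ?_
    rw [interior_Icc] at ha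
    obtain ⟨m, hm, he⟩ := hsign a
    rw [(hf a).deriv, he]
    exact mul_pos hm (h a ha)
  have hneg : ∀ {x y}, (∀ a ∈ Set.Ioo x y, g a < 0) → StrictAntiOn f (Set.Icc x y) := by
    intro x y h
    refine strictAntiOn_of_deriv_neg (convex_Icc _ _) hfc.continuousOn fun a ha => ?_
    rw [interior_Icc] at ha
    obtain ⟨m, hm, he⟩ := hsign a
    rw [(hf a).deriv, he]
    exact mul_neg_of_pos_of_neg hm (h a ha)
  have hempty : (∀ a ∈ Set.Icc A B, ψ < f a) → {a ∈ Set.Icc A B | f a = ψ}.Finite ∧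
      Even ({a ∈ Set.Icc A B | f a = ψ}.ncard +
        {a ∈ Set.Icc A B | f a = ψ ∧ g a = 0}.ncard) := by
    intro h
    have e1 : {a ∈ Set.Icc A B | f a = ψ} = ∅ :=
      Set.eq_empty_of_forall_notMem fun a ha => (h a ha.1).ne' ha.2
    have e2 : {a ∈ Set.Icc A B | f a = ψ ∧ g a = 0} = ∅ :=
      Set.eq_empty_of_forall_notMem fun a ha => (h a ha.1).ne' ha.2.1
    rw [e1, e2]
    simp
  have hAm := Set.left_mem_Icc.2 hAB
  have hBm := Set.right_mem_Icc.2 hAB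
  by_cases hz : ∃ m ∈ Set.Ioo A B, g m = 0
  · obtain ⟨m, hm, hgm⟩ := hz
    have hmI : m ∈ Set.Icc A B := Set.Ioo_subset_Icc_self hm
    have hlt : ∀ a ∈ Set.Ioo A m, g a < 0 := fun a ha =>
      hgm ▸ hmono ⟨ha.1.le, ha.2.le.trans hm.2.le⟩ hmI ha.2
    have hgt : ∀ a ∈ Set.Ioo m B, 0 < g a := fun a ha =>
      hgm ▸ hmono hmI ⟨hm.1.le.trans ha.1.le, ha.2.le⟩ ha.1
    have hanti := hneg hlt
    have hmon := hpos hgt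
    have hAm' : A ∈ Set.Icc A m := Set.left_mem_Icc.2 hm.1.le
    have hmm' : m ∈ Set.Icc A m := Set.right_mem_Icc.2 hm.1.le
    have hmm : m ∈ Set.Icc m B := Set.left_mem_Icc.2 hm.2.le
    have hmin : ∀ a ∈ Set.Icc A B, a ≠ m → f m < f a := fun a ha hne => by
      rcases lt_or_gt_of_ne hne with h | h
      · exact hanti ⟨ha.1, h.le⟩ hmm' h
      · exact hmon hmm ⟨h.le, ha.2⟩ h
    have hgz : ∀ a ∈ Set.Icc A B, g a = 0 → a = m := fun a ha h =>
      hmono.injOn ha hmI (h.trans hgm.symm)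
    -- The valley lies below, at or above the level: two simple solutions, one double solution, or
    -- none.
    rcases lt_trichotomy (f m) ψ with h | h | h
    · obtain ⟨x, hx, hfx⟩ := intermediate_value_Icc' hm.1.le hfc.continuousOn
        (show ψ ∈ Set.Icc (f m) (f A) from ⟨h.le, hA.le⟩)
      obtain ⟨y, hy, hfy⟩ := intermediate_value_Icc hm.2.le hfc.continuousOn
        (show ψ ∈ Set.Icc (f m) (f B) from ⟨h.le, hB.le⟩)
      have hxm : x ≠ m := by rintro rfl; linarith
      have hym : y ≠ m := by rintro rfl; linarith
      have hxy : x ≠ y := by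
        rintro rfl
        exact hxm (le_antisymm hx.2 hy.1)
      have e1 : {a ∈ Set.Icc A B | f a = ψ} = {x, y} := by
        ext a
        simp only [Set.mem_ofPred_eq, Set.mem_insert_iff, Set.mem_singleton_iff]
        constructor
        · rintro ⟨ha, hfa⟩
          rcases le_total a m with h' | h'
          · exact Or.inl (hanti.injOn ⟨ha.1, h'⟩ hx (hfa.trans hfx.symm))
          · exact Or.inr (hmon.injOn ⟨h', ha.2⟩ hy (hfa.trans hfy.symm))
        · rintro (rfl | rfl)
          · exact ⟨⟨hx.1, hx.2.trans hm.2.le⟩, hfx⟩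
          · exact ⟨⟨hm.1.le.trans hy.1, hy.2⟩, hfy⟩
      have e2 : {a ∈ Set.Icc A B | f a = ψ ∧ g a = 0} = ∅ :=
        Set.eq_empty_of_forall_notMem fun a ha => by
          have := hgz a ha.1 ha.2.2
          rw [← this, ha.2.1] at h
          exact lt_irrefl _ h
      rw [e1, e2, Set.ncard_pair hxy]
      simp
    · have e1 : {a ∈ Set.Icc A B | f a = ψ} = {m} := by
        ext a
        simp only [Set.mem_ofPred_eq, Set.mem_singleton_iff]
        constructor
        · rintro ⟨ha, hfa⟩
          by_contra hne
          have := hmin a ha hne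
          linarith
        · rintro rfl
          exact ⟨hmI, h⟩
      have e2 : {a ∈ Set.Icc A B | f a = ψ ∧ g a = 0} = {m} := by
        ext a
        simp only [Set.mem_ofPred_eq, Set.mem_singleton_iff]
        constructor
        · rintro ⟨ha, -, hga⟩
          exact hgz a ha hga
        · rintro rfl
          exact ⟨hmI, h, hgm⟩
      rw [e1, e2, Set.ncard_singleton]
      simp
    · refine hempty fun a ha => ?_
      rcases eq_or_ne a m with rfl | hne
      · exact h
      · exact h.trans (hmin a ha hne)
  · push Not at hz
    -- Without an interior zero `g` has constant sign on the open interval, so `f` is monotone and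
    -- stays above the smaller of its end values.
    by_cases hp : ∀ a ∈ Set.Ioo A B, 0 < g a
    · exact hempty fun a ha => hA.trans_le ((hpos hp).monotoneOn hAm ha ha.1)
    · push Not at hp
      obtain ⟨b, hb, hgb⟩ := hp
      have hgb' : g b < 0 := lt_of_le_of_ne hgb (hz b hb)
      have hn : ∀ a ∈ Set.Ioo A B, g a < 0 := fun a ha => by
        by_contra! h
        have hba : b ≤ a := by
          by_contra! hlt
          have := hmono (Set.Ioo_subset_Icc_self ha) (Set.Ioo_subset_Icc_self hb) hlt
          linarith
        obtain ⟨x, hx, hgx⟩ := intermediate_value_Icc hba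
          (hg.mono (Set.Icc_subset_Icc hb.1.le ha.2.le))
          (show (0 : ℝ) ∈ Set.Icc (g b) (g a) from ⟨hgb, h⟩)
        exact hz x ⟨hb.1.trans_le hx.1, hx.2.trans_lt ha.2⟩ hgx
      exact hempty fun a ha => hB.trans_le ((hneg hn).antitoneOn ha hBm ha.2)

/-- The parameters `(k, a)`, `k ∈ K`, of the geodesics whose endpoint has `|z₁| = c` and angle
`±ψ`. -/
def turnSolutions (c ψ : ℝ) (K : Set ℕ) : Set (ℕ × ℝ) :=
  {x | x.1 ∈ K ∧ x.2 ∈ Set.Icc 0 Real.pi ∧ turnPhase c x.1 x.2 = ψ}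

/-- The solutions which are counted twice. -/
def doubleTurnSolutions (c ψ : ℝ) (K : Set ℕ) : Set (ℕ × ℝ) :=
  {x ∈ turnSolutions c ψ K | tanDefect x.1 (turnAngle c x.2) = 0}

variable {c ψ : ℝ}

theorem tanDefect_zero_turnAngle_pos (hc : 0 ≤ c) (hc1 : c < 1) (a : ℝ) :
    0 < tanDefect 0 (turnAngle c a) := by
  have h := turnAngle_mem_Ioo hc hc1 a
  have := strictMonoOn_tanDefect 0 (Set.left_mem_Icc.2 Real.pi_pos.le)
    (Set.Ioo_subset_Icc_self h) h.1
  simpa [tanDefect_zero] using this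

theorem exists_level_zero (hc : 0 ≤ c) (hc1 : c < 1) (hψ : 0 ≤ ψ) (hψ' : ψ ≤ Real.pi) :
    ∃ b, {a ∈ Set.Icc 0 Real.pi | turnPhase c 0 a = ψ} = {b} := by
  have hm := strictMonoOn_turnPhase (k := 0) hc hc1 fun a _ =>
    tanDefect_zero_turnAngle_pos hc hc1 a
  obtain ⟨b, hb, hfb⟩ := intermediate_value_Icc Real.pi_pos.le
    (continuous_turnPhase hc hc1 0).continuousOn
    (show ψ ∈ Set.Icc (turnPhase c 0 0) (turnPhase c 0 Real.pi) by
      rw [turnPhase_zero, turnPhase_pi]; simpa using ⟨hψ, hψ'⟩)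
  refine ⟨b, ?_⟩
  ext a
  simp only [Set.mem_ofPred_eq, Set.mem_singleton_iff]
  exact ⟨fun h => hm.injOn h.1 hb (h.2.trans hfb.symm), fun h => h ▸ ⟨hb, hfb⟩⟩

theorem even_level_pos (hc : 0 ≤ c) (hc1 : c < 1) {k : ℕ} (hψ : ψ < k * Real.pi) :
    {a ∈ Set.Icc 0 Real.pi | turnPhase c k a = ψ}.Finite ∧
      Even ({a ∈ Set.Icc 0 Real.pi | turnPhase c k a = ψ}.ncard +
        {a ∈ Set.Icc 0 Real.pi | turnPhase c k a = ψ ∧ tanDefect k (turnAngle c a) = 0}.ncard) := by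
  have hpi := Real.pi_pos
  -- For `c = 0` the angle `y` is constantly `π/2`, so the valley lemma does not apply; but then
  -- `F_k(a) = kπ + a` never reaches the level.
  rcases hc.eq_or_lt with rfl | hc0
  · have h : ∀ a ∈ Set.Icc 0 Real.pi, turnPhase 0 k a ≠ ψ := fun a ha => by
      simp only [turnPhase, turnRatio, zero_mul, zero_div, sub_zero]
      have := ha.1
      intro h
      linarith
    have e1 : {a ∈ Set.Icc 0 Real.pi | turnPhase 0 k a = ψ} = ∅ :=
      Set.eq_empty_of_forall_notMem fun a ha => h a ha.1 ha.2
    have e2 : {a ∈ Set.Icc 0 Real.pi | turnPhase 0 k a = ψ ∧ tanDefect k (turnAngle 0 a) = 0} = ∅ :=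
      Set.eq_empty_of_forall_notMem fun a ha => h a ha.1 ha.2.1
    rw [e1, e2]
    simp
  · refine even_ncard_level_of_valley (g := fun a => tanDefect k (turnAngle c a)) hpi.le
      (hasDerivAt_turnPhase hc hc1 k)
      (fun a => ⟨_, div_pos (by linarith [turnRatio_sq_lt_one hc hc1 a])
        (sin_turnAngle_pos hc hc1 a), rfl⟩)
      ((continuous_tanDefect k).comp (continuous_turnAngle c)).continuousOn
      (fun a ha b hb hab => strictMonoOn_tanDefect k
        (Set.Ioo_subset_Icc_self (turnAngle_mem_Ioo hc hc1 a))
        (Set.Ioo_subset_Icc_self (turnAngle_mem_Ioo hc hc1 b))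
        (strictMonoOn_turnAngle hc0 hc1 ha hb hab)) ?_ ?_
    · rw [turnPhase_zero]; exact hψ
    · rw [turnPhase_pi]; linarith

theorem ncard_prod_singleton_left (k : ℕ) (s : Set ℝ) : (({k} : Set ℕ) ×ˢ s).ncard = s.ncard := by
  rw [Set.ncard_prod, Set.ncard_singleton, one_mul]

/-- The value `k = 0` contributes one simple solution and every other `k ∈ K` an even weighted
number; the sum is taken by induction on a cutoff for `k`. -/
theorem turnSolutions_finite_odd (hc : 0 ≤ c) (hc1 : c < 1) (hψ : 0 ≤ ψ) (hψ' : ψ ≤ Real.pi)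
    {K : Set ℕ} (h0 : 0 ∈ K) (hK : ∀ k ∈ K, k ≠ 0 → ψ < k * Real.pi) :
    (turnSolutions c ψ K).Finite ∧
      Odd ((turnSolutions c ψ K).ncard + (doubleTurnSolutions c ψ K).ncard) := by
  have hpi := Real.pi_pos
  have key : ∀ N : ℕ, (turnSolutions c ψ (K ∩ Set.Iio (N + 1))).Finite ∧
      Odd ((turnSolutions c ψ (K ∩ Set.Iio (N + 1))).ncard +
        (doubleTurnSolutions c ψ (K ∩ Set.Iio (N + 1))).ncard) := by
    intro N
    induction N with
    | zero =>
      obtain ⟨b, hb⟩ := exists_level_zero hc hc1 hψ hψ'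
      have e1 : turnSolutions c ψ (K ∩ Set.Iio (0 + 1)) = {(0, b)} := by
        ext ⟨k, a⟩
        have hb' := Set.ext_iff.1 hb a
        simp only [turnSolutions, Set.mem_ofPred_eq, Set.mem_singleton_iff, Prod.mk.injEq,
          Set.mem_inter_iff, Set.mem_Iio, zero_add, Nat.lt_one_iff] at hb' ⊢
        constructor
        · rintro ⟨⟨-, rfl⟩, ha⟩
          exact ⟨rfl, hb'.1 ha⟩
        · rintro ⟨rfl, h⟩
          exact ⟨⟨h0, rfl⟩, hb'.2 h⟩
      have e2 : doubleTurnSolutions c ψ (K ∩ Set.Iio (0 + 1)) = ∅ := by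
        refine Set.eq_empty_of_forall_notMem fun x hx => ?_
        have hx0 : x.1 = 0 := by
          have := hx.1.1.2
          simpa using this
        have := hx.2
        rw [hx0] at this
        exact (tanDefect_zero_turnAngle_pos hc hc1 x.2).ne' this
      rw [e1, e2]
      simp
    | succ N ih =>
      by_cases hN : N + 1 ∈ K
      · obtain ⟨hfin, heven⟩ := even_level_pos hc hc1 (hK _ hN (Nat.succ_ne_zero N))
        set L := {a ∈ Set.Icc 0 Real.pi | turnPhase c (N + 1) a = ψ}
        set D := {a ∈ Set.Icc 0 Real.pi |
          turnPhase c (N + 1) a = ψ ∧ tanDefect (N + 1) (turnAngle c a) = 0}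
        have hDL : D ⊆ L := fun a ha => ⟨ha.1, ha.2.1⟩
        have e1 : turnSolutions c ψ (K ∩ Set.Iio (N + 1 + 1)) =
            turnSolutions c ψ (K ∩ Set.Iio (N + 1)) ∪ {N + 1} ×ˢ L := by
          ext ⟨k, a⟩
          simp only [turnSolutions, L, Set.mem_ofPred_eq, Set.mem_union, Set.mem_prod,
            Set.mem_singleton_iff, Set.mem_inter_iff, Set.mem_Iio]
          constructor
          · rintro ⟨⟨h1, h2⟩, h3⟩
            rcases Nat.lt_succ_iff_lt_or_eq.1 h2 with h | rfl
            · exact Or.inl ⟨⟨h1, h⟩, h3⟩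
            · exact Or.inr ⟨rfl, h3⟩
          · rintro (⟨⟨h1, h2⟩, h3⟩ | ⟨rfl, h3⟩)
            · exact ⟨⟨h1, h2.trans (Nat.lt_succ_self _)⟩, h3⟩
            · exact ⟨⟨hN, Nat.lt_succ_self _⟩, h3⟩
        have e2 : doubleTurnSolutions c ψ (K ∩ Set.Iio (N + 1 + 1)) =
            doubleTurnSolutions c ψ (K ∩ Set.Iio (N + 1)) ∪ {N + 1} ×ˢ D := by
          unfold doubleTurnSolutions
          rw [e1]
          ext ⟨k, a⟩
          simp only [L, D, Set.mem_ofPred_eq, Set.mem_union, Set.mem_prod, Set.mem_singleton_iff]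
          constructor
          · rintro ⟨h1 | ⟨rfl, h1⟩, h2⟩
            · exact Or.inl ⟨h1, h2⟩
            · exact Or.inr ⟨rfl, h1.1, h1.2, h2⟩
          · rintro (⟨h1, h2⟩ | ⟨rfl, h1, h2, h3⟩)
            · exact ⟨Or.inl h1, h2⟩
            · exact ⟨Or.inr ⟨rfl, h1, h2⟩, h3⟩
        have hd : Disjoint (turnSolutions c ψ (K ∩ Set.Iio (N + 1))) ({N + 1} ×ˢ L) := by
          rw [Set.disjoint_left]
          rintro ⟨k, a⟩ h1 h2
          have h3 : k < N + 1 := h1.1.2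
          have h4 : k = N + 1 := h2.1
          omega
        have hsub : doubleTurnSolutions c ψ (K ∩ Set.Iio (N + 1)) ⊆
            turnSolutions c ψ (K ∩ Set.Iio (N + 1)) := fun x hx => hx.1
        have hd2 : Disjoint (doubleTurnSolutions c ψ (K ∩ Set.Iio (N + 1))) ({N + 1} ×ˢ D) :=
          hd.mono hsub (Set.prod_mono le_rfl hDL)
        have hfL : ({N + 1} ×ˢ L : Set (ℕ × ℝ)).Finite := (Set.finite_singleton _).prod hfin
        have hfD : ({N + 1} ×ˢ D : Set (ℕ × ℝ)).Finite :=
          (Set.finite_singleton _).prod (hfin.subset hDL)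
        refine ⟨by rw [e1]; exact ih.1.union hfL, ?_⟩
        rw [e1, e2, Set.ncard_union_eq hd ih.1 hfL, Set.ncard_union_eq hd2 (ih.1.subset hsub) hfD,
          ncard_prod_singleton_left, ncard_prod_singleton_left, add_add_add_comm]
        exact ih.2.add_even heven
      · have e : K ∩ Set.Iio (N + 1 + 1) = K ∩ Set.Iio (N + 1) := by
          ext k
          simp only [Set.mem_inter_iff, Set.mem_Iio]
          refine and_congr_right fun hk => ⟨fun h => ?_, fun h => by omega⟩
          rcases Nat.lt_succ_iff_lt_or_eq.1 h with h | rfl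
          · exact h
          · exact absurd hk hN
        rw [e]
        exact ih
  -- The cutoff comes from rewriting `kπ - c(k+1)π ≤ ψ` as `k(1-c)π ≤ ψ + cπ`.
  obtain ⟨N, hN⟩ := exists_nat_gt ((ψ + c * Real.pi) / ((1 - c) * Real.pi))
  have hbound : ∀ x ∈ turnSolutions c ψ K, x.1 < N + 1 := by
    rintro ⟨k, a⟩ ⟨-, ha, hF⟩
    have h1 := lower_bound_turnPhase hc hc1 k ha
    dsimp only at hF
    rw [hF] at h1
    have h3 : 0 < (1 - c) * Real.pi := mul_pos (by linarith) hpi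
    rw [div_lt_iff₀ h3] at hN
    have h2 : (k : ℝ) < N := by
      by_contra! hle
      nlinarith
    have : k < N := by exact_mod_cast h2
    dsimp only
    omega
  have e1 : turnSolutions c ψ (K ∩ Set.Iio (N + 1)) = turnSolutions c ψ K := by
    ext x
    exact ⟨fun h => ⟨h.1.1, h.2⟩, fun h => ⟨⟨h.1, hbound x h⟩, h.2⟩⟩
  have := key N
  unfold doubleTurnSolutions at this ⊢
  rwa [e1] at this

theorem turnSolutions_nonempty (hc : 0 ≤ c) (hc1 : c < 1) (hψ : 0 ≤ ψ) (hψ' : ψ ≤ Real.pi)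
    {K : Set ℕ} (h0 : 0 ∈ K) : (turnSolutions c ψ K).Nonempty := by
  obtain ⟨b, hb⟩ := exists_level_zero hc hc1 hψ hψ'
  have : b ∈ {a ∈ Set.Icc 0 Real.pi | turnPhase c 0 a = ψ} := by rw [hb]; rfl
  exact ⟨(0, b), h0, this⟩

/-- For `k = 1`, the bound `y ≥ arccos c ≥ η - π` keeps `y` to the right of the zero of the defect,
so `F_1` increases from `π > ψ`. For `k ≥ 2`, `c < 1/3` gives `F_k > (2k-1)π/3 ≥ π ≥ ψ`. -/
theorem turnSolutions_subsingleton (hc : 0 ≤ c) (hc1 : c < 1) (hψ : 0 ≤ ψ) (hψ' : ψ ≤ Real.pi)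
    {K : Set ℕ} (hK : ∀ k ∈ K, k ≠ 0 → ψ < k * Real.pi) {η : ℝ}
    (hη : η ∈ Set.Icc Real.pi (3 * Real.pi / 2)) (hηt : Real.tan η = η)
    (hle : η - Real.pi ≤ Real.arccos c) : (turnSolutions c ψ K).Subsingleton := by
  have hpi := Real.pi_pos
  have hpi3 := Real.pi_gt_three
  have hne : η ≠ Real.pi := by
    rintro rfl
    rw [Real.tan_pi] at hηt
    linarith
  have hlt : Real.pi < η := lt_of_le_of_ne hη.1 hne.symm
  have hw : η - Real.pi ∈ Set.Ioo 0 Real.pi := ⟨by linarith, by linarith [hη.2]⟩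
  have hg : tanDefect 1 (η - Real.pi) = 0 :=
    (tan_eq_self_iff 1 hw).1 (by simpa using hηt)
  -- Since `tan η = η`, `c ≤ cos(η - π) = sin(η - π)/η ≤ 1/η`, and `η > π > 3`.
  have hc3 : c < 1 / 3 := by
    have h1 : c ≤ Real.cos (η - Real.pi) := by
      have := Real.cos_le_cos_of_nonneg_of_le_pi hw.1.le (Real.arccos_le_pi c) hle
      rwa [Real.cos_arccos (by linarith) hc1.le] at this
    have h2 : Real.sin (η - Real.pi) = η * Real.cos (η - Real.pi) := by
      have := hg
      simp only [tanDefect, Nat.cast_one, one_mul] at this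
      have e : Real.pi + (η - Real.pi) = η := by ring
      rw [e] at this
      linarith
    have h3 := Real.sin_le_one (η - Real.pi)
    by_contra! hge
    nlinarith
  have h1 : ∀ x ∈ turnSolutions c ψ K, x.1 = 0 := by
    rintro ⟨k, a⟩ ⟨hk, ha, hF⟩
    dsimp only at hF hk ha ⊢
    by_contra hk0
    have hlt := hK k hk hk0
    rcases (Nat.one_le_iff_ne_zero.2 hk0).eq_or_lt with rfl | hk2
    · have hm := strictMonoOn_turnPhase (k := 1) hc hc1 fun b hb => by
        have hyb := turnAngle_mem_Ioo hc hc1 b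
        have hle' : η - Real.pi ≤ turnAngle c b := hle.trans (by
          apply Real.arccos_le_arccos
          nlinarith [Real.cos_le_one b])
        refine lt_of_le_of_ne ?_ fun h => ?_
        · rw [← hg]
          exact (strictMonoOn_tanDefect 1).monotoneOn (Set.Ioo_subset_Icc_self hw)
            (Set.Ioo_subset_Icc_self hyb) hle'
        -- Equality would give `c cos b = c` with `cos b < 1`, hence `c = 0`; but then `y = π/2`,
        -- where the defect is `1`.
        · have he := (strictMonoOn_tanDefect 1).injOn (Set.Ioo_subset_Icc_self hw)
            (Set.Ioo_subset_Icc_self hyb) (hg.trans h)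
          have he2 : Real.arccos c = Real.arccos (c * Real.cos b) := by
            refine le_antisymm ?_ ?_
            · apply Real.arccos_le_arccos
              nlinarith [Real.cos_le_one b]
            · rw [he] at hle
              exact hle
          have h4 := cos_turnAngle hc hc1 b
          rw [turnAngle, ← he2, Real.cos_arccos (by linarith) hc1.le] at h4
          have hcb : Real.cos b < 1 := by
            have := Real.cos_lt_cos_of_nonneg_of_le_pi le_rfl hb.2.le hb.1
            simpa using this
          have hc0 : c = 0 := by nlinarith
          rw [turnAngle, hc0] at h
          simp [tanDefect] at h
      have := hm.monotoneOn (Set.left_mem_Icc.2 hpi.le) ha ha.1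
      rw [turnPhase_zero, hF] at this
      linarith
    · have h5 := lower_bound_turnPhase hc hc1 k ha
      rw [hF] at h5
      have hk2' : (2 : ℝ) ≤ k := by exact_mod_cast hk2
      have h6 : c * ((k + 1) * Real.pi) < 1 / 3 * ((k + 1) * Real.pi) :=
        mul_lt_mul_of_pos_right hc3 (by positivity)
      nlinarith
  rintro ⟨k, a⟩ hx ⟨k', a'⟩ hx'
  obtain rfl : k = 0 := h1 _ hx
  obtain rfl : k' = 0 := h1 _ hx'
  obtain ⟨b, hb⟩ := exists_level_zero hc hc1 hψ hψ'
  have e1 : a ∈ ({b} : Set ℝ) := hb ▸ hx.2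
  have e2 : a' ∈ ({b} : Set ℝ) := hb ▸ hx'.2
  rw [Set.mem_singleton_iff.1 e1, Set.mem_singleton_iff.1 e2]

end Count

/-! ### Equivalence of the endpoint problem with `F_k(a) = ψ` -/

section Scalar

variable {c : ℝ}

theorem cos_nat_mul_pi_add (k : ℕ) (x : ℝ) :
    Real.cos (k * Real.pi + x) = (-1) ^ k * Real.cos x := by
  rw [add_comm, Real.cos_add_nat_mul_pi]

theorem sin_nat_mul_pi_add (k : ℕ) (x : ℝ) :
    Real.sin (k * Real.pi + x) = (-1) ^ k * Real.sin x := by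
  rw [add_comm, Real.sin_add_nat_mul_pi]

/-- The parameter `a` is the angle of `cos y + iσ sin y`, a number of modulus `c` in the upper half
plane; adding `kπ` to the argument adds `kπ` to the angle. -/
theorem exists_turn_of_ratio_pos (hc : 0 ≤ c) {σ y : ℝ} (hσ : 0 < σ) (hσ1 : σ ≤ 1)
    (k : ℕ) (hy : y ∈ Set.Ioo 0 Real.pi)
    (h : c ^ 2 = Real.cos y ^ 2 + σ ^ 2 * Real.sin y ^ 2) :
    ellipseAngle σ (k * Real.pi + y) - k * Real.pi ∈ Set.Icc 0 Real.pi ∧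
      turnAngle c (ellipseAngle σ (k * Real.pi + y) - k * Real.pi) = y ∧
      turnRatio c (ellipseAngle σ (k * Real.pi + y) - k * Real.pi) = σ := by
  have ha := ellipseAngle_mem_Icc hσ hσ1 k (Set.Ioo_subset_Icc_self hy)
  obtain ⟨r, hr, h1, h2⟩ := exists_cos_sin_ellipseAngle hσ hσ1 (k * Real.pi + y)
  obtain ⟨a, haL⟩ : ∃ a, a = ellipseAngle σ (k * Real.pi + y) - k * Real.pi := ⟨_, rfl⟩
  have hL : ellipseAngle σ (k * Real.pi + y) = k * Real.pi + a := by rw [haL]; ring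
  rw [hL, cos_nat_mul_pi_add, cos_nat_mul_pi_add] at h1
  rw [hL, sin_nat_mul_pi_add, sin_nat_mul_pi_add] at h2
  rw [← haL] at ha ⊢
  have hk : ((-1 : ℝ) ^ k) ≠ 0 := by positivity
  have h1' : Real.cos y = r * Real.cos a := mul_left_cancel₀ hk (by linarith)
  have h2' : σ * Real.sin y = r * Real.sin a := mul_left_cancel₀ hk (by linarith)
  have hrc : r = c := by
    refine (pow_left_inj₀ hr.le hc two_ne_zero).1 ?_
    rw [h, ← mul_pow, h1', h2']
    linear_combination (-r ^ 2) * Real.cos_sq_add_sin_sq a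
  rw [hrc] at h1' h2'
  have hya : turnAngle c a = y := by
    rw [turnAngle, ← h1', Real.arccos_cos hy.1.le hy.2.le]
  refine ⟨ha, hya, ?_⟩
  rw [turnRatio, hya, ← h2', mul_div_cancel_right₀ _ (Real.sin_pos_of_mem_Ioo hy).ne']

theorem sq_eq_cos_sq_add_turnRatio (hc : 0 ≤ c) (hc1 : c < 1) (a : ℝ) :
    c ^ 2 = Real.cos (turnAngle c a) ^ 2 + turnRatio c a ^ 2 * Real.sin (turnAngle c a) ^ 2 := by
  rw [← mul_pow, turnRatio_mul_sin hc hc1, cos_turnAngle hc hc1]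
  linear_combination (-c ^ 2) * Real.cos_sq_add_sin_sq a

theorem ellipseAngle_turnRatio (hc : 0 ≤ c) (hc1 : c < 1) {a : ℝ} (ha : a ∈ Set.Icc 0 Real.pi)
    (hpos : 0 < turnRatio c a) (k : ℕ) :
    ellipseAngle (turnRatio c a) (k * Real.pi + turnAngle c a) = k * Real.pi + a := by
  obtain ⟨h1, h2, -⟩ := exists_turn_of_ratio_pos hc hpos (turnRatio_lt_one hc hc1 a).le k
    (turnAngle_mem_Ioo hc hc1 a) (sq_eq_cos_sq_add_turnRatio hc hc1 a)
  have hc0 : c ≠ 0 := by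
    rintro rfl
    simp [turnRatio] at hpos
  have h3 := congrArg Real.cos h2
  rw [cos_turnAngle hc hc1, cos_turnAngle hc hc1] at h3
  have := Real.injOn_cos h1 ha (mul_left_cancel₀ hc0 h3)
  linarith

theorem mem_evenWindings_iff {k : ℕ} {y : ℝ} (hy : y ∈ Set.Ioo 0 Real.pi) :
    k * Real.pi + y ∈ evenWindings ↔ Even k := by
  have hpi := Real.pi_pos
  constructor
  · rintro ⟨m, h1, h2⟩
    have h3 : (2 * m : ℝ) < k + 1 := by
      by_contra! h
      nlinarith [hy.2]
    have h4 : (k : ℝ) < 2 * m + 1 := by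
      by_contra! h
      nlinarith [hy.1]
    have h3' : 2 * m < k + 1 := by exact_mod_cast h3
    have h4' : k < 2 * m + 1 := by exact_mod_cast h4
    exact ⟨m, by omega⟩
  · rintro ⟨m, rfl⟩
    refine ⟨m, ?_, ?_⟩ <;> push_cast <;> nlinarith [hy.1, hy.2]

/-- The sign of the angle of `q`, with value `1` if the angle vanishes. -/
def argSign (q : ℂ) : ℝ := if Complex.arg q < 0 then -1 else 1

theorem argSign_eq (q : ℂ) : argSign q = 1 ∨ argSign q = -1 := by
  unfold argSign
  split_ifs <;> simp

theorem argSign_mul_abs (q : ℂ) : argSign q * |Complex.arg q| = Complex.arg q := by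
  unfold argSign
  split_ifs with h
  · rw [abs_of_neg h]; ring
  · rw [abs_of_nonneg (not_lt.1 h), one_mul]

theorem exp_I_mul_argSign (q : ℂ) (x : ℝ) : Complex.exp (Complex.I * (argSign q * x : ℝ)) =
    Real.cos x + Complex.I * (argSign q * Real.sin x : ℝ) := by
  rw [mul_comm, Complex.exp_mul_I, ← Complex.ofReal_cos, ← Complex.ofReal_sin]
  rcases argSign_eq q with h | h <;> rw [h] <;> simp <;> ring

/-- The endpoint condition for the first coordinate of the geodesic with parameters `η`, `σ`. -/
def EndCondition (q : ℂ) (η σ : ℝ) : Prop :=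
  (Real.cos η + Complex.I * (σ * Real.sin η : ℝ) : ℂ) =
    Complex.exp (Complex.I * (σ * η : ℝ)) * q

theorem EndCondition.norm_sq {q : ℂ} {η σ : ℝ} (h : EndCondition q η σ) :
    ‖q‖ ^ 2 = Real.cos η ^ 2 + σ ^ 2 * Real.sin η ^ 2 := by
  have h1 := congrArg (fun w : ℂ => Complex.normSq w) h
  simp only [Complex.normSq_mul] at h1
  rw [Complex.normSq_eq_norm_sq (Complex.exp _), mul_comm Complex.I (((σ * η : ℝ) : ℂ)),
    Complex.norm_exp_ofReal_mul_I, Complex.normSq_eq_norm_sq q, Complex.normSq_apply] at h1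
  simp only [Complex.add_re, Complex.add_im, Complex.ofReal_re, Complex.ofReal_im, Complex.mul_re,
    Complex.mul_im, Complex.I_re, Complex.I_im] at h1
  linarith

/-- With `ε` the sign of the angle, `e^{iεση} q = c e^{iε(ση + ψ)} = c e^{iε(kπ + a)}`, and the real
and imaginary parts of the last number are `cos η` and `εσ sin η`. -/
theorem endCondition_of_turnPhase {q : ℂ} (hq : ‖q‖ < 1) {k : ℕ} {a : ℝ}
    (h : turnPhase ‖q‖ k a = |Complex.arg q|) :
    EndCondition q (k * Real.pi + turnAngle ‖q‖ a) (argSign q * turnRatio ‖q‖ a) := by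
  have hc := norm_nonneg q
  set η := k * Real.pi + turnAngle ‖q‖ a with hη
  have e : argSign q * turnRatio ‖q‖ a * η + Complex.arg q = argSign q * (k * Real.pi + a) := by
    conv_lhs => rw [← argSign_mul_abs q, ← h]
    unfold turnPhase
    ring
  have hr : Complex.exp (Complex.I * (argSign q * turnRatio ‖q‖ a * η : ℝ)) * q =
      ‖q‖ * Complex.exp (Complex.I * (argSign q * (k * Real.pi + a) : ℝ)) := by
    refine (congrArg _ (Complex.norm_mul_exp_arg_mul_I q).symm).trans ?_
    rw [← e, mul_left_comm, ← Complex.exp_add]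
    congr 2
    push_cast
    ring
  unfold EndCondition
  rw [hr, exp_I_mul_argSign, hη, cos_nat_mul_pi_add, sin_nat_mul_pi_add, cos_nat_mul_pi_add,
    sin_nat_mul_pi_add, cos_turnAngle hc hq]
  have hs := turnRatio_mul_sin hc hq a
  have e2 : argSign q * turnRatio ‖q‖ a * ((-1) ^ k * Real.sin (turnAngle ‖q‖ a)) =
      ‖q‖ * (argSign q * ((-1) ^ k * Real.sin a)) := by
    linear_combination argSign q * (-1) ^ k * hs
  rw [e2]
  push_cast
  ring

theorem EndCondition.of_ratio_zero {q : ℂ} {η : ℝ} (h : EndCondition q η 0) :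
    q = Real.cos η := by
  unfold EndCondition at h
  simpa using h.symm

theorem isLocalAngle_of_turnPhase {q : ℂ} (hq : ‖q‖ < 1) {t : ℝ} (ht : 0 < t) {k : ℕ} {a : ℝ}
    (ha : a ∈ Set.Icc 0 Real.pi) (h : turnPhase ‖q‖ k a = |Complex.arg q|)
    (hW : k * Real.pi + turnAngle ‖q‖ a ∈ evenWindings ∨ Complex.arg q ≠ Real.pi) :
    IsLocalAngle t (Complex.arg q)
      (crFirst (argSign q * turnRatio ‖q‖ a * ((k * Real.pi + turnAngle ‖q‖ a) / t))
        ((k * Real.pi + turnAngle ‖q‖ a) / t)) := by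
  have hc := norm_nonneg q
  have hpi := Real.pi_pos
  have hy := turnAngle_mem_Ioo hc hq a
  have hend := endCondition_of_turnPhase hq h
  have hL := ellipseAngle_turnRatio hc hq ha (k := k)
  set η := k * Real.pi + turnAngle ‖q‖ a with hη
  have hη0 : 0 < η := by
    have : 0 ≤ k * Real.pi := by positivity
    linarith [hy.1]
  have hΩ : 0 < η / t := div_pos hη0 ht
  have hΩt : η / t * t = η := div_mul_cancel₀ _ ht.ne'
  rcases (turnRatio_nonneg hc hq ha).eq_or_lt with h0 | hpos
  · rw [← h0, mul_zero] at hend ⊢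
    rw [zero_mul]
    have hqc := hend.of_ratio_zero
    -- If `σ = 0`, then `kπ + a = |arg q| ≤ π`. The only alternative to `k = 0` is `(k, a) = (1, 0)`
    -- with angle `π`, the spurious case removed by `hW`.
    have hk : k = 0 := by
      by_contra hk
      have hk1 : (1 : ℝ) ≤ k := by exact_mod_cast Nat.one_le_iff_ne_zero.2 hk
      have h1 := Complex.abs_arg_le_pi q
      rw [← h, turnPhase, ← h0, zero_mul, sub_zero] at h1
      have hk2 : (k : ℝ) = 1 := by nlinarith [ha.1]
      have ha0 : a = 0 := by rw [hk2] at h1; linarith [ha.1]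
      rw [turnPhase, ← h0, hk2, ha0] at h
      have harg : |Complex.arg q| = Real.pi := by linarith
      rcases hW with hW | hW
      · rw [mem_evenWindings_iff hy] at hW
        have : k = 1 := by exact_mod_cast hk2
        rw [this] at hW
        exact absurd hW (by decide)
      · rcases abs_eq hpi.le |>.1 harg with h2 | h2
        · exact hW h2
        · have := Complex.neg_pi_lt_arg q
          linarith
    have hηpi : η / t * t ≤ Real.pi := by
      rw [hΩt, hη, hk]; simpa using hy.2.le
    have := isLocalAngle_crFirst_zero hΩ.le hηpi
    rwa [crFirst_zero_left, hΩt, ← hqc] at this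
  · have hτ : 0 < turnRatio ‖q‖ a * (η / t) := mul_pos hpos hΩ
    have hτΩ : turnRatio ‖q‖ a * (η / t) ≤ η / t := by
      nlinarith [turnRatio_lt_one hc hq a]
    have hloc := isLocalAngle_crFirst (t := t) hΩ hτ hτΩ
    have hval : ellipseAngle (turnRatio ‖q‖ a * (η / t) / (η / t)) (η / t * t) -
        turnRatio ‖q‖ a * (η / t) / (η / t) * (η / t * t) = |Complex.arg q| := by
      rw [mul_div_cancel_right₀ _ hΩ.ne', hΩt, hη, hL hpos, ← h, turnPhase]
    rw [hval] at hloc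
    rw [← argSign_mul_abs q]
    rcases argSign_eq q with h1 | h1
    · rwa [h1, one_mul, one_mul]
    · rw [h1, neg_one_mul, neg_one_mul, neg_mul]
      have := hloc.conj
      simpa only [← crFirst_neg] using this

theorem exists_turnPhase_of_isLocalAngle {q : ℂ} (hq : ‖q‖ < 1) {t η σ : ℝ} (ht : 0 < t)
    (hη : 0 < η) (hs : Real.sin η ≠ 0) (hend : EndCondition q η σ)
    (hloc : IsLocalAngle t (Complex.arg q) (crFirst (σ * (η / t)) (η / t)))
    (hW : η ∈ evenWindings ∨ Complex.arg q ≠ Real.pi) :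
    ∃ (k : ℕ) (a : ℝ), a ∈ Set.Icc 0 Real.pi ∧ η = k * Real.pi + turnAngle ‖q‖ a ∧
      σ = argSign q * turnRatio ‖q‖ a ∧ turnPhase ‖q‖ k a = |Complex.arg q| := by
  have hc := norm_nonneg q
  have hpi := Real.pi_pos
  have hΩ : 0 < η / t := div_pos hη ht
  have hΩt : η / t * t = η := div_mul_cancel₀ _ ht.ne'
  obtain ⟨k, y, hy, hky⟩ : ∃ (k : ℕ) (y : ℝ), y ∈ Set.Ioo 0 Real.pi ∧ η = k * Real.pi + y := by
    have h1 := Nat.floor_le (div_nonneg hη.le hpi.le)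
    have h2 := Nat.lt_floor_add_one (η / Real.pi)
    rw [le_div_iff₀ hpi] at h1
    rw [div_lt_iff₀ hpi] at h2
    refine ⟨⌊η / Real.pi⌋₊, η - ⌊η / Real.pi⌋₊ * Real.pi, ⟨?_, by linarith⟩, by ring⟩
    refine lt_of_le_of_ne (by linarith) fun h => hs ?_
    have : η = ⌊η / Real.pi⌋₊ * Real.pi := by linarith
    rw [this, Real.sin_nat_mul_pi]
  have hn := hend.norm_sq
  have hsy := Real.sin_pos_of_mem_Ioo hy
  have hnk : ‖q‖ ^ 2 = Real.cos y ^ 2 + σ ^ 2 * Real.sin y ^ 2 := by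
    rw [hky, cos_nat_mul_pi_add, sin_nat_mul_pi_add, mul_pow, mul_pow, ← pow_mul, mul_comm k 2,
      pow_mul, neg_one_sq, one_pow, one_mul, one_mul] at hn
    exact hn
  have hσ1 : σ ^ 2 < 1 := by
    have h1 : ‖q‖ ^ 2 < 1 := by nlinarith
    have h2 : (1 - σ ^ 2) * Real.sin y ^ 2 = 1 - ‖q‖ ^ 2 := by
      rw [hnk]; linear_combination Real.cos_sq_add_sin_sq y
    by_contra! h
    nlinarith [mul_nonneg (sub_nonneg.2 h) (sq_nonneg (Real.sin y))]
  -- Treats positive ratios; it is applied to `σ`, or to `-σ` and the conjugate curve.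
  have hpos : ∀ σ' ψ, 0 < σ' → σ' ^ 2 = σ ^ 2 → |ψ| ≤ Real.pi →
      IsLocalAngle t ψ (crFirst (σ' * (η / t)) (η / t)) →
      0 < ψ ∧ ∃ a, a ∈ Set.Icc 0 Real.pi ∧ η = k * Real.pi + turnAngle ‖q‖ a ∧
        σ' = turnRatio ‖q‖ a ∧ turnPhase ‖q‖ k a = ψ := by
    intro σ' ψ hσ' hsq hψ hl
    have hσ'1 : σ' < 1 := by nlinarith
    have hψe := hl.eq_of_crFirst ht.le hΩ (mul_pos hσ' hΩ) (by nlinarith) hψ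
    rw [mul_div_cancel_right₀ _ hΩ.ne', hΩt] at hψe
    obtain ⟨h1, h2, h3⟩ := exists_turn_of_ratio_pos hc hσ' hσ'1.le k hy (by rw [hsq]; exact hnk)
    refine ⟨hψe ▸ ellipseAngle_sub_pos hσ' hσ'1 hη, _, h1, by rw [h2, hky], h3.symm, ?_⟩
    rw [turnPhase, h2, h3, hψe, hky]
    ring
  have habs := Complex.abs_arg_le_pi q
  rcases lt_trichotomy σ 0 with hσ | rfl | hσ
  · have hl := hloc.conj
    simp only [← crFirst_neg, ← neg_mul] at hl
    obtain ⟨hlt, a, ha, h1, h2, h3⟩ := hpos (-σ) _ (by linarith) (by ring)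
      (by rwa [abs_neg]) hl
    refine ⟨k, a, ha, h1, ?_, ?_⟩
    · rw [← h2, argSign, if_pos (by linarith)]; ring
    · rw [h3, abs_of_neg (by linarith)]
  · have hqc := hend.of_ratio_zero
    rw [zero_mul] at hloc
    obtain ⟨hl0, hlpi⟩ := hloc.zero_left ht hΩ
    rw [hΩt] at hl0 hlpi
    -- For `σ = 0` the solution sits at an end of the interval for `k = 0`: `a = 0` for angle `0`,
    -- `a = π` for angle `π`. In the second case locality gives only `η ≤ 3π/2`, and evenness of `k`
    -- excludes `k = 1`.
    rcases le_or_gt 0 (Real.cos η) with hcos | hcos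
    · have harg : Complex.arg q = 0 := by rw [hqc]; exact Complex.arg_ofReal_of_nonneg hcos
      have hη2 := hl0 harg
      have hnq : ‖q‖ = Real.cos η := by
        rw [hqc, Complex.norm_real, Real.norm_of_nonneg hcos]
      refine ⟨0, 0, ⟨le_rfl, hpi.le⟩, ?_, by simp [turnRatio], ?_⟩
      · rw [turnAngle, hnq, Real.cos_zero, mul_one, Real.arccos_cos hη.le (by linarith)]
        simp
      · rw [turnPhase_zero, harg]; simp
    · have harg : Complex.arg q = Real.pi := by rw [hqc]; exact Complex.arg_ofReal_of_neg hcos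
      have hη2 := hlpi harg
      have hnq : ‖q‖ = -Real.cos η := by
        rw [hqc, Complex.norm_real, Real.norm_of_nonpos hcos.le]
      have hW' := hW.resolve_right (not_not.2 harg)
      rw [hky, mem_evenWindings_iff hy] at hW'
      have hk0 : k = 0 := by
        have hk2 : (k : ℝ) < 2 := by
          by_contra! h
          have := hy.1
          nlinarith
        have hk2' : k < 2 := by exact_mod_cast hk2
        obtain ⟨m, rfl⟩ := hW'
        omega
      have hηpi : η ≤ Real.pi := by
        rw [hky, hk0]; simpa using hy.2.le
      refine ⟨0, Real.pi, ⟨hpi.le, le_rfl⟩, ?_, by simp [turnRatio], ?_⟩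
      · rw [turnAngle, hnq, Real.cos_pi, mul_neg_one, neg_neg, Real.arccos_cos hη.le hηpi]
        simp
      · rw [turnPhase_pi, harg, abs_of_pos hpi]; simp
  · obtain ⟨hlt, a, ha, h1, h2, h3⟩ := hpos σ _ hσ rfl habs hloc
    refine ⟨k, a, ha, h1, ?_, ?_⟩
    · rw [← h2, argSign, if_neg (by linarith)]; ring
    · rw [h3, abs_of_pos hlt]

end Scalar

/-! ### From the scalar parameters to geodesics on the sphere -/

section Vector

variable {n : ℕ} {t : ℝ} {Q : CSpace n}

/-- The initial momentum of the geodesic from `1` to `Q` with parameters `η = Ωt` and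
`σ = τ₁/Ω`. -/
def initialMomentum (t : ℝ) (Q : CSpace n) (η σ : ℝ) : CSpace n :=
  ((η / t / Real.sin η : ℝ) : ℂ) •
    (Complex.exp (Complex.I * (σ * η : ℝ)) • Q - ((Real.cos η : ℝ) : ℂ) • basePoint n)

theorem initialMomentum_zero {η σ : ℝ} (hs : Real.sin η ≠ 0) (h : EndCondition (Q 0) η σ) :
    initialMomentum t Q η σ 0 = Complex.I * ((σ * (η / t) : ℝ) : ℂ) := by
  unfold EndCondition at h
  simp only [initialMomentum, PiLp.smul_apply, PiLp.sub_apply, smul_eq_mul, basePoint_zero, ← h]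
  have hs' : ((Real.sin η : ℝ) : ℂ) ≠ 0 := by exact_mod_cast hs
  rw [Complex.ofReal_div, Complex.ofReal_mul, Complex.ofReal_mul]
  field_simp
  ring

/-- By the endpoint condition, `e^{iση} Q` has real inner product `cos η` with `1`, so its
difference from `cos η 1` has norm `|sin η|`. -/
theorem norm_initialMomentum (hQ : ‖Q‖ = 1) {η σ : ℝ} (ht : 0 < t) (hη : 0 < η)
    (hs : Real.sin η ≠ 0) (h : EndCondition (Q 0) η σ) :
    ‖initialMomentum t Q η σ‖ = η / t := by
  unfold EndCondition at h
  have hexp : ‖Complex.exp (Complex.I * (σ * η : ℝ))‖ = 1 := by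
    rw [mul_comm, Complex.norm_exp_ofReal_mul_I]
  have h1 : ‖Complex.exp (Complex.I * (σ * η : ℝ)) • Q -
      ((Real.cos η : ℝ) : ℂ) • basePoint n‖ ^ 2 = Real.sin η ^ 2 := by
    have hin : inner ℂ (Complex.exp (Complex.I * (σ * η : ℝ)) • Q)
        (((Real.cos η : ℝ) : ℂ) • basePoint n) = (starRingEnd ℂ)
          (Real.cos η * (Real.cos η + Complex.I * (σ * Real.sin η : ℝ))) := by
      rw [← inner_conj_symm, inner_smul_left, inner_smul_right, inner_basePoint, h,
        Complex.conj_ofReal]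
    rw [@norm_sub_sq ℂ, hin, norm_smul, norm_smul, hexp, hQ, norm_basePoint, Complex.norm_real,
      Real.norm_eq_abs, RCLike.re_eq_complex_re, Complex.conj_re, Complex.re_ofReal_mul]
    simp only [Complex.add_re, Complex.mul_re, Complex.I_re, Complex.I_im, Complex.ofReal_re,
      Complex.ofReal_im, mul_one, sq_abs]
    linear_combination (-1 : ℝ) * Real.cos_sq_add_sin_sq η
  have h2 : ‖Complex.exp (Complex.I * (σ * η : ℝ)) • Q -
      ((Real.cos η : ℝ) : ℂ) • basePoint n‖ = |Real.sin η| := by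
    rw [← Real.sqrt_sq (norm_nonneg _), h1, Real.sqrt_sq_eq_abs]
  rw [initialMomentum, norm_smul, h2, Complex.norm_real, Real.norm_eq_abs, abs_div,
    div_mul_cancel₀ _ (abs_ne_zero.2 hs), abs_of_pos (div_pos hη ht)]

theorem crCurve_initialMomentum {η σ : ℝ} (ht : 0 < t) (hη : 0 < η) (hs : Real.sin η ≠ 0) :
    crCurve (σ * (η / t)) (η / t) (initialMomentum t Q η σ) t = Q := by
  have hΩt : η / t * t = η := div_mul_cancel₀ _ ht.ne'
  have e : Real.sin η / (η / t) * (η / t / Real.sin η) = 1 := by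
    have := (div_pos hη ht).ne'
    field_simp
  have hexp : Complex.exp (-(Complex.I * (σ * η : ℝ))) * Complex.exp (Complex.I * (σ * η : ℝ)) =
      1 := by
    rw [← Complex.exp_add]; simp
  rw [crCurve, initialMomentum, mul_assoc, hΩt, smul_smul, ← Complex.ofReal_mul, e,
    Complex.ofReal_one, one_smul, add_sub_cancel, smul_smul, hexp, one_smul]

theorem eq_initialMomentum {η σ : ℝ} {v : CSpace n} (ht : 0 < t) (hη : 0 < η)
    (hs : Real.sin η ≠ 0) (h : crCurve (σ * (η / t)) (η / t) v t = Q) :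
    v = initialMomentum t Q η σ := by
  have hΩt : η / t * t = η := div_mul_cancel₀ _ ht.ne'
  have e : η / t / Real.sin η * (Real.sin η / (η / t)) = 1 := by
    have := (div_pos hη ht).ne'
    field_simp
  have hexp : Complex.exp (Complex.I * (σ * η : ℝ)) * Complex.exp (-(Complex.I * (σ * η : ℝ))) =
      1 := by
    rw [← Complex.exp_add]; simp
  rw [initialMomentum, ← h, crCurve, mul_assoc, hΩt, smul_smul, hexp, one_smul,
    add_sub_cancel_left, smul_smul, ← Complex.ofReal_mul, e, Complex.ofReal_one, one_smul]

theorem exists_ne_zero_apply (hQ : ‖Q‖ = 1) (hQ0 : ‖Q 0‖ < 1) : ∃ j ≠ 0, Q j ≠ 0 := by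
  by_contra! h
  have : Q = EuclideanSpace.single 0 (Q 0) := by
    ext j
    rcases eq_or_ne j 0 with rfl | hj
    · simp
    · simp [h j hj, hj]
  rw [this, PiLp.norm_single] at hQ
  linarith

/-- The parameter `η` of the geodesic with parameters `(k, a)`. -/
def turnParameter (Q : CSpace n) (x : ℕ × ℝ) : ℝ := x.1 * Real.pi + turnAngle ‖Q 0‖ x.2

/-- The geodesic with parameters `(k, a)`. -/
def turnCurve (t : ℝ) (Q : CSpace n) (x : ℕ × ℝ) : ℝ → CSpace n :=
  crCurve (argSign (Q 0) * turnRatio ‖Q 0‖ x.2 * (turnParameter Q x / t)) (turnParameter Q x / t)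
    (initialMomentum t Q (turnParameter Q x) (argSign (Q 0) * turnRatio ‖Q 0‖ x.2))

theorem turnParameter_pos (hQ0 : ‖Q 0‖ < 1) (x : ℕ × ℝ) : 0 < turnParameter Q x := by
  have h := (turnAngle_mem_Ioo (norm_nonneg (Q 0)) hQ0 x.2).1
  have := Real.pi_pos
  unfold turnParameter
  positivity

theorem sin_turnParameter_ne_zero (hQ0 : ‖Q 0‖ < 1) (x : ℕ × ℝ) :
    Real.sin (turnParameter Q x) ≠ 0 := by
  rw [turnParameter, sin_nat_mul_pi_add]
  have := sin_turnAngle_pos (norm_nonneg (Q 0)) hQ0 x.2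
  exact mul_ne_zero (by positivity) this.ne'

theorem crCurve_apply_zero_eq_crFirst {τ Ω : ℝ} {v : CSpace n} (hv0 : v 0 = Complex.I * τ)
    (s : ℝ) : crCurve τ Ω v s 0 = crFirst τ Ω s :=
  crCurve_apply_zero hv0 s

theorem crGeodesics_eq_image (ht : 0 < t) (hQ : ‖Q‖ = 1) (hQ0 : ‖Q 0‖ < 1) {W : Set ℝ}
    (hW : W ⊆ evenWindings ∨ phi1 Q ≠ Real.pi) :
    crGeodesics t Q W = (fun x => (Set.Icc (0 : ℝ) t).domRestrict (turnCurve t Q x)) ''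
      {x ∈ turnSolutions ‖Q 0‖ |Complex.arg (Q 0)| Set.univ | turnParameter Q x ∈ W} := by
  have h0m : (0 : ℝ) ∈ Set.Icc 0 t := Set.left_mem_Icc.2 ht.le
  have htm : t ∈ Set.Icc 0 t := Set.right_mem_Icc.2 ht.le
  ext γ
  constructor
  · rintro ⟨z, ⟨p, hb, hz0, hzt, ⟨φ, hm, hφ0, hφt, hφ⟩, hηW⟩, rfl⟩
    have hp : p 0 ≠ 0 := by
      intro hp
      have := hb.const_of_p_eq_zero hp t htm
      rw [hz0, hzt] at this
      rw [this, basePoint_zero] at hQ0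
      simp at hQ0
    have hcurve := hb.eq_crCurve ht.le hz0 hp
    have hp0 := hb.p_zero_apply ht.le hz0
    have hΩ : 0 < ‖p 0‖ := norm_pos_iff.2 hp
    set Ω := ‖p 0‖ with hΩdef
    set τ := (p 0 0).im with hτ
    set η := Ω * t with hη
    have hη0 : 0 < η := mul_pos hΩ ht
    have hηt : η / t = Ω := by rw [hη, mul_div_cancel_right₀ _ ht.ne']
    have hστ : τ / Ω * (η / t) = τ := by rw [hηt, div_mul_cancel₀ _ hΩ.ne']
    have hfirst : ∀ s ∈ Set.Icc 0 t, z s 0 = crFirst τ Ω s := fun s hs => by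
      rw [hcurve s hs, crCurve_apply_zero_eq_crFirst hp0]
    have hend : EndCondition (Q 0) η (τ / Ω) := by
      have h1 := hfirst t htm
      rw [hzt, crFirst] at h1
      unfold EndCondition
      have e : τ / Ω * η = τ * t := by rw [hη]; field_simp
      rw [h1, e, ← mul_assoc, ← Complex.exp_add]
      simp [hη]
    -- If `sin η = 0`, the endpoint would have `|z₁| = 1`.
    have hs : Real.sin η ≠ 0 := by
      intro hs
      have h1 := hend.norm_sq
      have h2 := Real.cos_sq_add_sin_sq η
      rw [hs] at h1 h2
      nlinarith [norm_nonneg (Q 0)]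
    have hloc : IsLocalAngle t (Complex.arg (Q 0)) (crFirst (τ / Ω * (η / t)) (η / t)) := by
      rw [hστ, hηt]
      refine ⟨φ, hm, hφ0, by rw [hφt, hzt, phi1], fun s hs => ?_⟩
      rw [← hfirst s hs]
      exact hφ s hs
    obtain ⟨k, a, ha, h1, h2, h3⟩ := exists_turnPhase_of_isLocalAngle hQ0 ht hη0 hs hend hloc
      (hW.imp (fun h => h hηW) id)
    have hpar : turnParameter Q (k, a) = η := h1.symm
    refine ⟨(k, a), ⟨⟨Set.mem_univ _, ha, h3⟩, by rw [hpar]; exact hηW⟩, ?_⟩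
    funext s
    change turnCurve t Q (k, a) s = z s
    rw [turnCurve, hpar, ← h2, hcurve s s.2, hcurve t htm] at *
    have hpi := eq_initialMomentum (σ := τ / Ω) (v := p 0) ht hη0 hs (by rw [hστ, hηt, hzt])
    rw [← hpi, hστ, hηt]
  · rintro ⟨x, ⟨⟨-, ha, hx⟩, hxW⟩, rfl⟩
    have hη0 := turnParameter_pos hQ0 x
    have hs := sin_turnParameter_ne_zero hQ0 x
    have hend : EndCondition (Q 0) (turnParameter Q x) (argSign (Q 0) * turnRatio ‖Q 0‖ x.2) :=
      endCondition_of_turnPhase hQ0 hx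
    have hloc := isLocalAngle_of_turnPhase hQ0 ht ha hx (hW.imp (fun h => h hxW) id)
    have hv0 := initialMomentum_zero (t := t) hs hend
    have hv := norm_initialMomentum hQ ht hη0 hs hend
    have hΩ := (div_pos hη0 ht).ne'
    have htQ : turnCurve t Q x t = Q := crCurve_initialMomentum ht hη0 hs
    refine ⟨turnCurve t Q x, ⟨_, isCRBicharacteristic_crCurve hΩ hv0 hv t, crCurve_zero _ _ _,
      htQ, ?_, ?_⟩, rfl⟩
    · obtain ⟨φ, hm, hφ0, hφt, hφ⟩ := hloc
      refine ⟨φ, hm, hφ0, by rw [htQ, hφt, phi1], fun s hs => ?_⟩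
      have e : turnCurve t Q x s 0 = _ := crCurve_apply_zero_eq_crFirst hv0 s
      rw [e]
      exact hφ s hs
    · rw [crMomentum_zero, hv, div_mul_cancel₀ _ ht.ne']
      exact hxW

/-- The curve determines `τ` and `v`, hence `Ω = ‖v‖`, `η` and `σ`. Then `k` follows from `0 < y <
π`, and `a` from the common value of `F_k`. -/
theorem injOn_turnCurve (ht : 0 < t) (hQ : ‖Q‖ = 1) (hQ0 : ‖Q 0‖ < 1) :
    (turnSolutions ‖Q 0‖ |Complex.arg (Q 0)| Set.univ).InjOn
      (fun x => (Set.Icc (0 : ℝ) t).domRestrict (turnCurve t Q x)) := by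
  intro x hx x' hx' heq
  have hcurve : ∀ s ∈ Set.Icc 0 t, turnCurve t Q x s = turnCurve t Q x' s := fun s hs =>
    congrFun heq ⟨s, hs⟩
  obtain ⟨j, hj, hQj⟩ := exists_ne_zero_apply hQ hQ0
  have hη := turnParameter_pos hQ0 x
  have hη' := turnParameter_pos hQ0 x'
  have hs := sin_turnParameter_ne_zero hQ0 x
  have hvj : initialMomentum t Q (turnParameter Q x) (argSign (Q 0) * turnRatio ‖Q 0‖ x.2) j ≠ 0 := by
    have hb : basePoint n j = 0 := by simp [basePoint, hj]
    simp only [initialMomentum, PiLp.smul_apply, PiLp.sub_apply, hb, smul_eq_mul, mul_zero,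
      sub_zero]
    refine mul_ne_zero ?_ (mul_ne_zero (Complex.exp_ne_zero _) hQj)
    exact_mod_cast div_ne_zero (div_pos hη ht).ne' hs
  obtain ⟨hτ, hv⟩ := crCurve_injective ht (div_pos hη ht).ne' (div_pos hη' ht).ne' hj hvj hcurve
  have hn := congrArg norm hv
  rw [norm_initialMomentum hQ ht hη hs (endCondition_of_turnPhase hQ0 hx.2.2),
    norm_initialMomentum hQ ht hη' (sin_turnParameter_ne_zero hQ0 x')
      (endCondition_of_turnPhase hQ0 hx'.2.2)] at hn
  rw [← hn] at hτ
  have hσ := mul_right_cancel₀ (div_pos hη ht).ne' hτ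
  have hε : argSign (Q 0) ≠ 0 := by
    rcases argSign_eq (Q 0) with h | h <;> rw [h] <;> norm_num
  have hσ := mul_left_cancel₀ hε hσ
  have hηη := (div_left_inj' ht.ne').1 hn
  obtain ⟨k, a⟩ := x
  obtain ⟨k', a'⟩ := x'
  have hk : k = k' := by
    have h1 := turnAngle_mem_Ioo (norm_nonneg (Q 0)) hQ0 a
    have h2 := turnAngle_mem_Ioo (norm_nonneg (Q 0)) hQ0 a'
    have hpi := Real.pi_pos
    simp only [turnParameter] at hηη
    have h3 : (k : ℝ) < k' + 1 := by
      by_contra! h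
      nlinarith [h1.1, h2.2]
    have h4 : (k' : ℝ) < k + 1 := by
      by_contra! h
      nlinarith [h2.1, h1.2]
    have h3' : k < k' + 1 := by exact_mod_cast h3
    have h4' : k' < k + 1 := by exact_mod_cast h4
    omega
  subst hk
  have h5 := hx.2.2.trans hx'.2.2.symm
  simp only [turnPhase, turnParameter] at h5 hηη hσ
  rw [hηη, hσ] at h5
  have : a = a' := by linarith
  rw [this]

end Vector

/-! ### Counting geodesics by solutions of the scalar equation -/

section Count

variable {n : ℕ} {t : ℝ} {Q : CSpace n} {W : Set ℝ} {K : Set ℕ}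

/-- The intervals `(kπ, (k+1)π)` meeting `W` are those with `k ∈ K`. -/
def IsWindingRange (W : Set ℝ) (K : Set ℕ) : Prop :=
  ∀ (k : ℕ), ∀ y ∈ Set.Ioo 0 Real.pi, k * Real.pi + y ∈ W ↔ k ∈ K

theorem setOf_turnParameter_mem (hQ0 : ‖Q 0‖ < 1) (hK : IsWindingRange W K) (ψ : ℝ) :
    {x ∈ turnSolutions ‖Q 0‖ ψ Set.univ | turnParameter Q x ∈ W} = turnSolutions ‖Q 0‖ ψ K := by
  ext ⟨k, a⟩
  have h := hK k _ (turnAngle_mem_Ioo (norm_nonneg (Q 0)) hQ0 a)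
  simp only [turnSolutions, turnParameter, Set.mem_ofPred_eq, Set.mem_univ, true_and, h]
  tauto

theorem setOf_turnParameter_mem_double (hQ0 : ‖Q 0‖ < 1) (hK : IsWindingRange W K) (ψ : ℝ) :
    {x ∈ turnSolutions ‖Q 0‖ ψ Set.univ | turnParameter Q x ∈ W ∩ doubleParameters} =
      doubleTurnSolutions ‖Q 0‖ ψ K := by
  rw [doubleTurnSolutions, ← setOf_turnParameter_mem hQ0 hK ψ]
  ext ⟨k, a⟩
  have h := tan_eq_self_iff k (turnAngle_mem_Ioo (norm_nonneg (Q 0)) hQ0 a)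
  simp only [Set.mem_ofPred_eq, Set.mem_inter_iff, doubleParameters, turnParameter, h]
  tauto

theorem crGeodesics_eq_image_turnSolutions (ht : 0 < t) (hQ : ‖Q‖ = 1) (hQ0 : ‖Q 0‖ < 1)
    (hW : W ⊆ evenWindings ∨ phi1 Q ≠ Real.pi) (hK : IsWindingRange W K) :
    crGeodesics t Q W = (fun x => (Set.Icc (0 : ℝ) t).domRestrict (turnCurve t Q x)) ''
      turnSolutions ‖Q 0‖ |Complex.arg (Q 0)| K := by
  rw [crGeodesics_eq_image ht hQ hQ0 hW, setOf_turnParameter_mem hQ0 hK]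

theorem crGeodesicCount_eq (ht : 0 < t) (hQ : ‖Q‖ = 1) (hQ0 : ‖Q 0‖ < 1)
    (hW : W ⊆ evenWindings ∨ phi1 Q ≠ Real.pi) (hK : IsWindingRange W K) :
    crGeodesicCount t Q W = (turnSolutions ‖Q 0‖ |Complex.arg (Q 0)| K).ncard +
      (doubleTurnSolutions ‖Q 0‖ |Complex.arg (Q 0)| K).ncard := by
  have hinj := injOn_turnCurve ht hQ hQ0
  rw [crGeodesicCount, crGeodesics_eq_image ht hQ hQ0 hW,
    crGeodesics_eq_image ht hQ hQ0 (W := W ∩ doubleParameters)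
      (hW.imp (fun h => Set.inter_subset_left.trans h) id),
    (hinj.mono fun x hx => hx.1).ncard_image,
    (hinj.mono fun x hx => hx.1).ncard_image,
    setOf_turnParameter_mem hQ0 hK, setOf_turnParameter_mem_double hQ0 hK]

/-- Both choices of `W` serve to make `ψ < kπ` strict for `k ≠ 0`: either `k ≥ 2` by evenness, or `ψ
< π`. -/
theorem exists_windingRange (hW : W = evenWindings ∨ (W = Set.univ ∧ phi1 Q ≠ Real.pi)) :
    ∃ K : Set ℕ, IsWindingRange W K ∧ 0 ∈ K ∧
      ∀ k ∈ K, k ≠ 0 → |Complex.arg (Q 0)| < k * Real.pi := by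
  have hpi := Real.pi_pos
  have habs := Complex.abs_arg_le_pi (Q 0)
  rcases hW with rfl | ⟨rfl, hφ⟩
  · refine ⟨{k | Even k}, fun k y hy => mem_evenWindings_iff hy, Even.zero, fun k hk hk0 => ?_⟩
    have h2 : 2 ≤ k := by
      obtain ⟨m, rfl⟩ := hk
      omega
    have h2' : (2 : ℝ) ≤ k := by exact_mod_cast h2
    nlinarith
  · refine ⟨Set.univ, fun k y _ => by simp, Set.mem_univ _, fun k _ hk0 => ?_⟩
    have h1 : (1 : ℝ) ≤ k := by exact_mod_cast Nat.one_le_iff_ne_zero.2 hk0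
    have h2 : |Complex.arg (Q 0)| < Real.pi := by
      rw [abs_lt]
      exact ⟨Complex.neg_pi_lt_arg _, lt_of_le_of_ne (Complex.arg_le_pi _) hφ⟩
    nlinarith

end Count

/-! ### Lengths -/

section Length

variable {n : ℕ} {t : ℝ}

theorem norm_deriv_crCurve {τ Ω : ℝ} {v : CSpace n} (hΩ : Ω ≠ 0) (hv0 : v 0 = Complex.I * τ)
    (hv : ‖v‖ = Ω) (s : ℝ) : ‖deriv (crCurve τ Ω v) s‖ = Real.sqrt (Ω ^ 2 - τ ^ 2) := by
  have h : ‖deriv (crCurve τ Ω v) s‖ ^ 2 = Ω ^ 2 - τ ^ 2 := by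
    rw [(hasDerivAt_crCurve hΩ s).deriv, @norm_sub_sq ℂ, inner_smul_right, ← inner_conj_symm,
      inner_crCurve_crMomentum hΩ hv0 hv, norm_crMomentum hv0 hv, norm_smul,
      norm_crCurve hΩ hv0 hv, norm_mul, Complex.norm_I, Complex.norm_real, Real.norm_eq_abs]
    simp
    ring
  rw [← h, Real.sqrt_sq (norm_nonneg _)]

theorem curveLength_crCurve {τ Ω : ℝ} {v : CSpace n} (hΩ : Ω ≠ 0) (hv0 : v 0 = Complex.I * τ)
    (hv : ‖v‖ = Ω) (t : ℝ) :
    curveLength t (crCurve τ Ω v) = t * Real.sqrt (Ω ^ 2 - τ ^ 2) := by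
  simp [curveLength, norm_deriv_crCurve hΩ hv0 hv]

theorem curveLength_congr (ht : 0 ≤ t) {z z' : ℝ → CSpace n} (h : Set.EqOn z z' (Set.Icc 0 t)) :
    curveLength t z = curveLength t z' := by
  unfold curveLength
  rw [intervalIntegral.integral_of_le ht, intervalIntegral.integral_of_le ht,
    MeasureTheory.integral_Ioc_eq_integral_Ioo, MeasureTheory.integral_Ioc_eq_integral_Ioo]
  refine MeasureTheory.setIntegral_congr_fun measurableSet_Ioo fun s hs => ?_
  have : z =ᶠ[nhds s] z' := Filter.eventually_of_mem (Icc_mem_nhds hs.1 hs.2) h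
  simp only [this.deriv_eq]

theorem crGeodesics_infinite_of_lengths (ht : 0 ≤ t) {Q : CSpace n} {W : Set ℝ}
    (h : (curveLength t '' crGeodesicCurves t Q W).Infinite) : (crGeodesics t Q W).Infinite := by
  intro hfin
  refine h ((hfin.image fun c : Set.Icc (0 : ℝ) t → CSpace n =>
    curveLength t (Set.IccExtend ht c)).subset ?_)
  rintro _ ⟨z, hz, rfl⟩
  refine ⟨_, ⟨z, hz, rfl⟩, curveLength_congr ht fun s hs => ?_⟩
  rw [Set.IccExtend_of_mem ht _ hs]
  rfl

end Length

/-! ### Endpoints on the circle `|z₁| = 1` -/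

section Vertical

variable {n : ℕ} {t : ℝ} {Q : CSpace n}

theorem nat_mul_pi_mem_evenWindings (k : ℕ) : k * Real.pi ∈ evenWindings := by
  have hpi := Real.pi_pos
  refine ⟨k / 2, ?_, ?_⟩
  · refine mul_le_mul_of_nonneg_right ?_ hpi.le
    exact_mod_cast (by omega : 2 * (k / 2) ≤ k)
  · refine mul_le_mul_of_nonneg_right ?_ hpi.le
    exact_mod_cast (by omega : k ≤ 2 * (k / 2) + 1)

theorem eq_smul_basePoint (hQ : ‖Q‖ = 1) (hQ0 : ‖Q 0‖ = 1) : Q = Q 0 • basePoint n := by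
  have h := EuclideanSpace.norm_sq_eq Q
  rw [hQ, Fin.sum_univ_succ, hQ0, one_pow, left_eq_add,
    Finset.sum_eq_zero_iff_of_nonneg fun _ _ => sq_nonneg _] at h
  ext j
  refine Fin.cases ?_ (fun i => ?_) j
  · simp [basePoint]
  · have := h i (Finset.mem_univ i)
    rw [sq_eq_zero_iff, norm_eq_zero] at this
    simp [basePoint, this]

/-- Take `η = kπ` and `|τ| t = η - ψ`: the ellipse angle at `η` is exactly `kπ`, so the final angle
is `ψ` up to sign. The squared length is `η² - (η - ψ)²`. -/
theorem exists_geodesic_of_norm_eq_one (hn : 1 ≤ n) (ht : 0 < t) (hQ : ‖Q‖ = 1)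
    (hQ0 : ‖Q 0‖ = 1) (harg : Complex.arg (Q 0) ≠ 0) {W : Set ℝ} {k : ℕ} (hk : 2 ≤ k)
    (hkW : k * Real.pi ∈ W) :
    Real.sqrt (2 * k * Real.pi * |Complex.arg (Q 0)| - Complex.arg (Q 0) ^ 2) ∈
      curveLength t '' crGeodesicCurves t Q W := by
  have hpi := Real.pi_pos
  have hψ : 0 < |Complex.arg (Q 0)| := abs_pos.2 harg
  have hψπ := Complex.abs_arg_le_pi (Q 0)
  have hε := argSign_mul_abs (Q 0)
  have hε2 : argSign (Q 0) ^ 2 = 1 := by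
    rcases argSign_eq (Q 0) with h | h <;> rw [h] <;> norm_num
  rw [← sq_abs (Complex.arg (Q 0))]
  set ψ := |Complex.arg (Q 0)|
  set ε := argSign (Q 0) with hεdef
  have hk' : (2 : ℝ) ≤ k := by exact_mod_cast hk
  set η := k * Real.pi with hη
  -- Here `k ≥ 2` is used: `ψ ≤ π < kπ`, so `τ` below is positive.
  have hηψ : ψ < η := by nlinarith
  have hη0 : 0 < η := hψ.trans hηψ
  set Ω := η / t with hΩdef
  have hΩ : 0 < Ω := div_pos hη0 ht
  have hΩt : Ω * t = η := div_mul_cancel₀ _ ht.ne'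
  set τ := (η - ψ) / t with hτdef
  have hτ : 0 < τ := div_pos (by linarith) ht
  have hτΩ : τ ≤ Ω := div_le_div_of_nonneg_right (by linarith) ht.le
  have hτt : τ * t = η - ψ := div_mul_cancel₀ _ ht.ne'
  have hετ : (ε * τ) ^ 2 = τ ^ 2 := by rw [mul_pow, hε2, one_mul]
  have hdiff : 0 ≤ Ω ^ 2 - τ ^ 2 := by nlinarith
  -- A direction orthogonal to `1` exists because `n ≥ 1`; it carries the rest of the momentum and
  -- drops out at time `t`, since `sin η = 0`.
  obtain ⟨j, hj⟩ : ∃ j : Fin (n + 1), j ≠ 0 :=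
    ⟨Fin.last n, by rw [Ne, Fin.ext_iff]; simp; omega⟩
  set v : CSpace n := EuclideanSpace.single 0 (Complex.I * ((ε * τ : ℝ) : ℂ)) +
    EuclideanSpace.single j ((Real.sqrt (Ω ^ 2 - τ ^ 2) : ℝ) : ℂ) with hvdef
  have hv0 : v 0 = Complex.I * ((ε * τ : ℝ) : ℂ) := by
    simp [hvdef, hj.symm]
  have hv : ‖v‖ = Ω := by
    have h : ‖v‖ ^ 2 = Ω ^ 2 := by
      rw [hvdef, @norm_add_sq ℂ, PiLp.norm_single, PiLp.norm_single,
        EuclideanSpace.inner_single_left]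
      simp only [PiLp.single_apply, if_neg hj.symm, norm_mul, Complex.norm_I, Complex.norm_real,
        Real.norm_eq_abs, one_mul, mul_zero, map_zero, sq_abs, add_zero, Real.sq_sqrt hdiff]
      rw [← abs_mul, sq_abs, hετ]
      ring
    exact (pow_left_inj₀ (norm_nonneg _) hΩ.le two_ne_zero).1 h
  have hend : crCurve (ε * τ) Ω v t = Q := by
    have h1 : Complex.exp (-(Complex.I * (ε * τ * t : ℝ))) * ((Real.cos η : ℝ) : ℂ) = Q 0 := by
      have h2 := exp_I_mul_argSign (Q 0) η
      rw [hη, Real.sin_nat_mul_pi, mul_zero, Complex.ofReal_zero, mul_zero, add_zero, ← hη,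
        ← hεdef] at h2
      rw [← h2, ← Complex.exp_add, ← Complex.norm_mul_exp_arg_mul_I (Q 0), hQ0,
        Complex.ofReal_one, one_mul]
      have h3 : ε * η - ε * τ * t = Complex.arg (Q 0) := by
        rw [mul_assoc, hτt, ← hε]; ring
      rw [← h3]
      congr 1
      push_cast
      ring
    have h4 : Real.sin η = 0 := Real.sin_nat_mul_pi k
    rw [crCurve, hΩt, h4, zero_div, Complex.ofReal_zero, zero_smul, add_zero, smul_smul, h1]
    exact (eq_smul_basePoint hQ hQ0).symm
  have hloc : IsLocalAngle t (Complex.arg (Q 0)) (crFirst (ε * τ) Ω) := by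
    have h1 := isLocalAngle_crFirst (t := t) hΩ hτ hτΩ
    have h2 : ellipseAngle (τ / Ω) (Ω * t) - τ / Ω * (Ω * t) = ψ := by
      rw [hΩt, hη, ellipseAngle_nat_mul_pi, ← hη, ← hΩt, ← mul_assoc, div_mul_cancel₀ _ hΩ.ne',
        hτt, hΩt]
      ring
    rw [h2] at h1
    rw [← hε]
    rcases argSign_eq (Q 0) with h | h
    · rwa [hεdef, h, one_mul, one_mul]
    · rw [hεdef, h, neg_one_mul, neg_one_mul]
      simpa only [← crFirst_neg] using h1.conj
  refine ⟨crCurve (ε * τ) Ω v, ⟨_, isCRBicharacteristic_crCurve hΩ.ne' hv0 hv t,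
    crCurve_zero _ _ _, hend, ?_, ?_⟩, ?_⟩
  · obtain ⟨φ, hm, hφ0, hφt, hφ⟩ := hloc
    refine ⟨φ, hm, hφ0, by rw [hend, hφt, phi1], fun s hs => ?_⟩
    rw [crCurve_apply_zero_eq_crFirst hv0]
    exact hφ s hs
  · rwa [crMomentum_zero, hv, hΩt]
  · rw [curveLength_crCurve hΩ.ne' hv0 hv, hετ]
    conv_lhs => rw [← Real.sqrt_sq ht.le]
    rw [← Real.sqrt_mul (sq_nonneg t)]
    congr 1
    have e : t ^ 2 * (Ω ^ 2 - τ ^ 2) = (Ω * t) ^ 2 - (τ * t) ^ 2 := by ring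
    rw [e, hΩt, hτt, hη]
    ring

theorem lengths_infinite_of_norm_eq_one (hn : 1 ≤ n) (ht : 0 < t) (hQ : ‖Q‖ = 1)
    (hQ0 : ‖Q 0‖ = 1) (hne : Q ≠ basePoint n) {W : Set ℝ} (hW : evenWindings ⊆ W) :
    (curveLength t '' crGeodesicCurves t Q W).Infinite := by
  have harg : Complex.arg (Q 0) ≠ 0 := fun h => hne (by
    have h1 := Complex.norm_mul_exp_arg_mul_I (Q 0)
    rw [hQ0, h] at h1
    simp only [Complex.ofReal_one, Complex.ofReal_zero, zero_mul, Complex.exp_zero, mul_one] at h1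
    rw [eq_smul_basePoint hQ hQ0, ← h1, one_smul])
  have hpi := Real.pi_pos
  have hψ : 0 < |Complex.arg (Q 0)| := abs_pos.2 harg
  have hψπ := Complex.abs_arg_le_pi (Q 0)
  refine Set.infinite_of_injective_forall_mem (f := fun m : ℕ =>
    Real.sqrt (2 * ((m + 2 : ℕ) : ℝ) * Real.pi * |Complex.arg (Q 0)| - Complex.arg (Q 0) ^ 2)) ?_
    fun m => exists_geodesic_of_norm_eq_one hn ht hQ hQ0 harg (by omega)
      (hW (nat_mul_pi_mem_evenWindings _))
  have hpos : ∀ m : ℕ, 0 ≤ 2 * ((m + 2 : ℕ) : ℝ) * Real.pi * |Complex.arg (Q 0)| -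
      Complex.arg (Q 0) ^ 2 := fun m => by
    rw [← sq_abs]
    push_cast
    have h1 : |Complex.arg (Q 0)| * |Complex.arg (Q 0)| ≤ Real.pi * |Complex.arg (Q 0)| :=
      mul_le_mul_of_nonneg_right hψπ hψ.le
    have h2 : 0 ≤ (m : ℝ) * (Real.pi * |Complex.arg (Q 0)|) := by positivity
    have h3 : 0 ≤ Real.pi * |Complex.arg (Q 0)| := by positivity
    nlinarith
  intro m m' h
  have h1 := (Real.sqrt_inj (hpos m) (hpos m')).1 h
  have h2 : ((m : ℝ) - m') * (2 * Real.pi * |Complex.arg (Q 0)|) = 0 := by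
    push_cast at h1
    linarith
  have h3 := (mul_eq_zero.1 h2).resolve_right (by positivity)
  exact_mod_cast sub_eq_zero.1 h3

end Vertical
end

/-! ### The theorem -/

theorem proposition5p35 (n : ℕ) (hn : 1 ≤ n) (t : ℝ) (ht : 0 < t)
    (Q : CSpace n) (hQ : ‖Q‖ = 1) (W : Set ℝ)
    (hW : W = evenWindings ∨ (W = Set.univ ∧ phi1 Q ≠ Real.pi)) :
    (0 < theta1 Q →
      (crGeodesics t Q W).Finite ∧ (crGeodesics t Q W).Nonempty ∧ Odd (crGeodesicCount t Q W)) ∧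
    (theta1 Q = 0 → Q ≠ basePoint n →
      (crGeodesics t Q W).Infinite ∧ (curveLength t '' crGeodesicCurves t Q W).Infinite) ∧
    (∃! η₁ : ℝ, η₁ ∈ Set.Icc Real.pi (3 * Real.pi / 2) ∧ Real.tan η₁ = η₁) ∧
    (∀ η₁ ∈ Set.Icc Real.pi (3 * Real.pi / 2), Real.tan η₁ = η₁ → η₁ - Real.pi ≤ theta1 Q →
      ∃! c : Set.Icc (0 : ℝ) t → CSpace n, c ∈ crGeodesics t Q W) := by
  have hpi := Real.pi_pos
  have hc := norm_nonneg (Q 0)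
  have habs := Complex.abs_arg_le_pi (Q 0)
  have hsub : W ⊆ evenWindings ∨ phi1 Q ≠ Real.pi := hW.imp (fun h => h.subset) fun h => h.2
  obtain ⟨K, hK, h0, hKψ⟩ := exists_windingRange hW
  have hlt : 0 < theta1 Q → ‖Q 0‖ < 1 := Real.arccos_pos.1
  refine ⟨fun hθ => ?_, fun hθ hne => ?_, existsUnique_tan_eq_self, fun η hη hηt hle => ?_⟩
  · have hQ0 := hlt hθ
    obtain ⟨hfin, hodd⟩ := turnSolutions_finite_odd hc hQ0 (abs_nonneg _) habs h0 hKψ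
    rw [crGeodesicCount_eq ht hQ hQ0 hsub hK,
      crGeodesics_eq_image_turnSolutions ht hQ hQ0 hsub hK]
    exact ⟨hfin.image _, (turnSolutions_nonempty hc hQ0 (abs_nonneg _) habs h0).image _, hodd⟩
  · have hQ0 : ‖Q 0‖ = 1 :=
      le_antisymm (hQ ▸ PiLp.norm_apply_le Q 0) (Real.arccos_eq_zero.1 hθ)
    have hW' : evenWindings ⊆ W := by
      rcases hW with rfl | ⟨rfl, -⟩
      · exact le_rfl
      · exact Set.subset_univ _
    have := lengths_infinite_of_norm_eq_one hn ht hQ hQ0 hne hW'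
    exact ⟨crGeodesics_infinite_of_lengths ht.le this, this⟩
  · have hne : η ≠ Real.pi := by
      rintro rfl
      rw [Real.tan_pi] at hηt
      linarith
    have hη1 : Real.pi < η := lt_of_le_of_ne hη.1 hne.symm
    have hQ0 := hlt (by linarith)
    have hsing := turnSolutions_subsingleton hc hQ0 (abs_nonneg _) habs hKψ hη hηt hle
    rw [crGeodesics_eq_image_turnSolutions ht hQ hQ0 hsub hK]
    obtain ⟨c, hcm⟩ := (turnSolutions_nonempty hc hQ0 (abs_nonneg (Complex.arg (Q 0))) habs
      h0).image fun x => (Set.Icc (0 : ℝ) t).domRestrict (turnCurve t Q x)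
    exact ⟨c, hcm, fun c' hc' => hsing.image _ hc' hcm⟩
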